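/- Conventions. A domain is a non-empty connected open set $D\subset\mathbb C$; $dA$ is area measure. A weight $\mu$ on $D$ (a positive measurable function) is admissible, $\mu\in AW(D)$, if the weighted Bergman space $A^2_\mu(D)=\{f\in\mathcal O(D):\int_D|f|^2\mu\,dA<\infty\}$ is closed in $L^2_\mu(D)$ and $f\mapsto f(z)$ is continuous on it for every $z\in D$. For $\mu\in AW(D)$, $n\ge 1$, $\zeta\in D$ let $$AD^\mu(D,\zeta^n)=\Big\{f\in\mathcal O(D): f(\zeta)=\dots=f^{(n-1)}(\zeta)=0,\ \int_D|f'|^2\mu\,dA<\infty\Big\},\qquad \langle f,g\rangle=\int_D f'\,\overline{g'}\,\mu\,dA ,$$ let $M_{D,\mu,n}(\cdot,\zeta)\in AD^\mu(D,\zeta^n)$ be the Riesz representative of $f\mapsto f^{(n)}(\zeta)$, and let $\tilde K_{D,\mu,n}(z,\zeta)=\frac{\partial}{\partial z}M_{D,\mu,n}(z,\zeta)$ be the $n$-th order weighted reduced Bergman kernel; write $\tilde K_{D,\mu}=\tilde K_{D,\mu,1}$. Let $N_D(\mu)=\{z\in D:\tilde K_{D,\mu}(z,z)=0\}$, let $$J_m(\zeta)=\det\Big(\frac{\partial^{j+k}}{\partial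 z^j\,\partial\bar\zeta^k}\tilde K_{D,\mu}(z,\zeta)\Big|_{z=\zeta}\Big)_{j,k=0}^{m},$$ and for $n\ge2$ let $R_n=R_n(D,\mu)=\{\zeta\in D\setminus N_D(\mu): J_{n-2}(\zeta)\neq 0\}$. (Thus $R_2=D\setminus N_D(\mu)$, and $R_n=D\setminus N_D(\mu)$ whenever $J_{n-2}>0$ on $D\setminus N_D(\mu)$, e.g. if $D$ is bounded and $\mu\in L^1(D)$.) Theorem. Let $\{D_i\}_{i\ge1}$ be a sequence of domains in $\mathbb C$ and $\mu_i\in AW(D_i)$. (1) Let $D=\bigcup_i D_i$ and $\mu\in AW(D)$. Assume that for every $i$ there is $j(i)$ such that $D_i\subset D_k$ and $\mu_i(z)\le\mu_k(z)\le\mu(z)$ for all $k\ge j(i)$ and $z\in D_i$, and that $\mu_i\to\mu$ pointwise a.e. on $D$. Then: (A) $\tilde K_{D_i,\mu_i}\to\tilde K_{D,\mu}$ locally uniformly on $D\times D$. (B) For every $n>1$ and $w\in D$, $\tilde K_{D_i,\mu_i,n}(\cdot,w)\to\tilde K_{D,\mu,n}(\cdot,w)$ locally uniformly on $D$; in particular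 $\tilde K_{D_i,\mu_i,n}\to\tilde K_{D,\mu,n}$ pointwise on $D\times D$. Furthermore, $\tilde K_{D,\mu,n}$ is $C^\infty$ on $D\times R_n$, on every compact subset of $D\times R_n$ the kernels $\tilde K_{D_i,\mu_i,n}$ are $C^\infty$ for all large $i$, and all derivatives of $\tilde K_{D_i,\mu_i,n}$ converge locally uniformly on $D\times R_n$ to the respective derivatives of $\tilde K_{D,\mu,n}$. (2) Suppose that $D=\bigcap_i D_i$ is a domain and that $\mu\in AW(D)$ satisfies $\mu(z)\le\mu_i(z)$ for all $i$ and $z\in D$. Assume that $\mu_i\to\mu$ pointwise a.e. on $D$ and that $\lim_{i\to\infty}\tilde K_{D_i,\mu_i}(t,t)=\tilde K_{D,\mu}(t,t)$ for every $t\in D$. Then: (A) $\tilde K_{D_i,\mu_i}\to\tilde K_{D,\mu}$ locally uniformly on $D\times D$. (B) For every $n>1$, $\tilde K_{D,\mu,n}$ is $C^\infty$ on $D\times R_n$, on every compact subset of $D\times R_n$ the kernels $\tilde K_{D_i,\mu_i,n}$ are $C^\infty$ for all large $i$, and all derivatives of $\tilde K_{D_i,\mu_i,n}$ converge locally uniformly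 on $D\times R_n$ to the respective derivatives of $\tilde K_{D,\mu,n}$. -/

import Mathlib

open MeasureTheory Filter Topology
open scoped ContDiff ComplexConjugate

noncomputable section

/-- The measure `μ dA` on `D`, where `dA` is the area measure of the plane. -/
def weightedArea (D : Set ℂ) (μ : ℂ → ℝ) : Measure ℂ :=
  (volume.restrict D).withDensity (fun z => ENNReal.ofReal (μ z))

/-- `f` belongs to the weighted Bergman space `A²_μ(D)`: it is holomorphic on `D` and
`∫_D |f|² μ dA < ∞`. -/
def MemBergman (D : Set ℂ) (μ : ℂ → ℝ) (f : ℂ → ℂ) : Prop :=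
  DifferentiableOn ℂ f D ∧ MemLp f 2 (weightedArea D μ)

/-- Admissible weights in the sense of Pasternak-Winiarski: a positive (Lebesgue) measurable
function on `D` for which the weighted Bergman space is closed in `L²_μ(D)` and all
point evaluations are bounded on it. Values of `μ` outside `D` play no role. -/
structure IsAdmissibleWeight (D : Set ℂ) (μ : ℂ → ℝ) : Prop where
  measurable : AEMeasurable μ (volume.restrict D)
  pos : ∀ z ∈ D, 0 < μ z
  closed : IsClosed {g : Lp ℂ 2 (weightedArea D μ) |
    ∃ f : ℂ → ℂ, MemBergman D μ f ∧ g =ᵐ[weightedArea D μ] f}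
  eval_bounded : ∀ z ∈ D, ∃ C : ℝ, ∀ f : ℂ → ℂ, MemBergman D μ f →
    ‖f z‖ ≤ C * (eLpNorm f 2 (weightedArea D μ)).toReal

/-- `f` belongs to `AD^μ(D, ζⁿ)`: it is holomorphic on `D`, it vanishes at `ζ` together with its
derivatives of order less than `n`, and `∫_D |f'|² μ dA < ∞`. -/
def MemAD (D : Set ℂ) (μ : ℂ → ℝ) (n : ℕ) (ζ : ℂ) (f : ℂ → ℂ) : Prop :=
  DifferentiableOn ℂ f D ∧ (∀ k < n, iteratedDeriv k f ζ = 0) ∧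
    MemLp (deriv f) 2 (weightedArea D μ)

/-- `M` represents the functional `f ↦ f⁽ⁿ⁾(ζ)` on `AD^μ(D, ζⁿ)` with respect to the inner product
`⟨f, g⟩ = ∫_D f' conj(g') μ dA`. -/
def IsKernelFunction (D : Set ℂ) (μ : ℂ → ℝ) (n : ℕ) (ζ : ℂ) (M : ℂ → ℂ) : Prop :=
  MemAD D μ n ζ M ∧ ∀ f : ℂ → ℂ, MemAD D μ n ζ f →
    iteratedDeriv n f ζ = ∫ z, deriv f z * conj (deriv M z) ∂(weightedArea D μ)

open Classical in
/-- The `n`-th order kernel function `M_{D,μ,n}(·, ζ)`, i.e. the Riesz representative of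
`f ↦ f⁽ⁿ⁾(ζ)`. For a domain `D`, an admissible weight `μ`, `ζ ∈ D` and `n ≥ 1` it exists and
is unique as a function on `D`; otherwise the value is `0` by convention. -/
def kernelFunction (D : Set ℂ) (μ : ℂ → ℝ) (n : ℕ) (ζ : ℂ) : ℂ → ℂ :=
  if h : ∃ M : ℂ → ℂ, IsKernelFunction D μ n ζ M then h.choose else 0

/-- The `n`-th order weighted reduced Bergman kernel
`K̃_{D,μ,n}(z, ζ) = ∂/∂z M_{D,μ,n}(z, ζ)`; `n = 1` is the weighted reduced Bergman kernel. -/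
def reducedKernel (D : Set ℂ) (μ : ℂ → ℝ) (n : ℕ) (z ζ : ℂ) : ℂ :=
  deriv (kernelFunction D μ n ζ) z

/-- The set `N_D(μ)` of zeros of the reduced Bergman kernel on the diagonal. -/
def diagZeros (D : Set ℂ) (μ : ℂ → ℝ) : Set ℂ :=
  {z | z ∈ D ∧ reducedKernel D μ 1 z z = 0}

/-- The mixed derivative `∂^{j+k} / ∂z^j ∂ζ̄^k` of the first-order kernel. Since the kernel is
anti-holomorphic in `ζ`, its `ζ̄`-derivative is the conjugate of the complex derivative of the
conjugated kernel. -/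
def kernelMixedDeriv (D : Set ℂ) (μ : ℂ → ℝ) (j k : ℕ) (z ζ : ℂ) : ℂ :=
  iteratedDeriv j
    (fun z' => conj (iteratedDeriv k (fun ζ' => conj (reducedKernel D μ 1 z' ζ')) ζ)) z

/-- The determinant `J_m(ζ)` of the matrix of mixed derivatives of orders `0 ≤ j, k ≤ m` of the
first-order kernel at `(ζ, ζ)`. -/
def kernelGramDet (D : Set ℂ) (μ : ℂ → ℝ) (m : ℕ) (ζ : ℂ) : ℂ :=
  Matrix.det (Matrix.of fun j k : Fin (m + 1) => kernelMixedDeriv D μ j k ζ ζ)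

/-- The points of `D \ N_D(μ)` at which `J_{n-2}` does not vanish (`n ≥ 2`). -/
def regularPoints (D : Set ℂ) (μ : ℂ → ℝ) (n : ℕ) : Set ℂ :=
  {ζ | ζ ∈ D \ diagZeros D μ ∧ kernelGramDet D μ (n - 2) ζ ≠ 0}

/-- All derivatives (in the real sense, hence all partial derivatives in `z, z̄, ζ, ζ̄`, of every
order including `0`) of `F i` converge locally uniformly on `U` to those of `f`. The derivatives
really exist: `f` is smooth at all points of `U`, and on each compact subset of `U` all
but finitely many of the `F i` are smooth. -/
def AllDerivsTendstoLocallyUniformlyOn (F : ℕ → ℂ × ℂ → ℂ) (f : ℂ × ℂ → ℂ)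
    (U : Set (ℂ × ℂ)) : Prop :=
  (∀ p ∈ U, ContDiffAt ℝ ∞ f p) ∧
  (∀ L ⊆ U, IsCompact L → ∀ᶠ i in atTop, ∀ p ∈ L, ContDiffAt ℝ ∞ (F i) p) ∧
  ∀ m : ℕ, TendstoLocallyUniformlyOn (fun i => iteratedFDeriv ℝ m (F i))
    (iteratedFDeriv ℝ m f) atTop U

end

/-!
The derivatives `f'` of the functions in `AD^μ(D, ζⁿ)` form a space of exact holomorphic functions
in `L²(μ dA)`, and the reduced kernel of order `n` represents `h ↦ h⁽ⁿ⁻¹⁾(ζ)` on its members that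
vanish at `ζ` to order `n - 1`. If `D' ⊆ D` and `μ' ≤ μ` on `D'`, with kernels `κ'` and `κ`, then
the reproducing property gives `‖κ' - κ‖²_{D'} ≤ ‖κ'‖²_{D'} - ‖κ‖²_D`, so that kernels are as close
as their norms.

Along an exhaustion the norms decrease, hence the kernels are locally uniformly Cauchy. The limit
lies in the limiting space and has the right value and, by Fatou's lemma, minimal norm, so it is the
kernel of `D`. In the second situation the assumption on the diagonal is the convergence of the
norms.

The first-order kernel is holomorphic in `z` and anti-holomorphic in `ζ`, so its locally uniform
convergence carries over to all mixed derivatives. By Gram-Schmidt, the higher-order kernel is a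
bordered Gram determinant of these mixed derivatives divided by `J_{n-2}`, which gives the smooth
convergence wherever `J_{n-2}` does not vanish.
-/

section Primitives

variable {ι F : Type*} [NormedAddCommGroup F] [NormedSpace ℂ F] {Ω : Set ℂ}
  {l : Filter ι}

theorem differentiableOn_iteratedDeriv [CompleteSpace F] (hΩ : IsOpen Ω) {f : ℂ → F}
    (hf : DifferentiableOn ℂ f Ω) (k : ℕ) : DifferentiableOn ℂ (iteratedDeriv k f) Ω := by
  induction k with
  | zero => simpa only [iteratedDeriv_zero] using hf
  | succ k ih => rw [iteratedDeriv_succ]; exact ih.deriv hΩ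

theorem tendstoLocallyUniformlyOn_iteratedDeriv [CompleteSpace F] [l.NeBot] (hΩ : IsOpen Ω)
    {f : ι → ℂ → F} {g : ℂ → F} (hlim : TendstoLocallyUniformlyOn f g l Ω)
    (hf : ∀ᶠ i in l, DifferentiableOn ℂ (f i) Ω) (k : ℕ) :
    TendstoLocallyUniformlyOn (fun i => iteratedDeriv k (f i)) (iteratedDeriv k g) l Ω := by
  induction k with
  | zero => simpa only [iteratedDeriv_zero] using hlim
  | succ k ih =>
    simp only [iteratedDeriv_succ]
    exact ih.deriv (hf.mono fun i hi => differentiableOn_iteratedDeriv hΩ hi k) hΩ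

theorem eqOn_iteratedDeriv {f g : ℂ → F} (hΩ : IsOpen Ω) (h : Set.EqOn f g Ω) (k : ℕ) :
    Set.EqOn (iteratedDeriv k f) (iteratedDeriv k g) Ω := fun _ hz =>
  (h.eventuallyEq_of_mem (hΩ.mem_nhds hz)).iteratedDeriv_eq k

theorem cauchy_map_of_uniformCauchySeqOn_deriv (hΩ : IsOpen Ω) (hc : IsPreconnected Ω)
    {f h : ι → ℂ → F} (hh : UniformCauchySeqOn h l Ω)
    (hf : ∀ᶠ i in l, ∀ z ∈ Ω, HasDerivAt (f i) (h i z) z) {x y : ℂ} (hx : x ∈ Ω) (hy : y ∈ Ω)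
    (hfx : Cauchy (map (fun i => f i x) l)) : Cauchy (map (fun i => f i y) l) := by
  let A : Set ι := {i | ∀ z ∈ Ω, HasDerivAt (f i) (h i z) z}
  have hl : map ((↑) : A → ι) (comap (↑) l) = l := map_comap_of_mem (by rwa [Subtype.range_coe])
  have hA : UniformCauchySeqOn
      (fun (i : A) z => ContinuousLinearMap.toSpanSingleton ℂ (h i z)) (comap (↑) l) Ω :=
    (ContinuousLinearMap.toSpanSingletonLIE ℂ F).isometry.uniformContinuous.comp_uniformCauchySeqOn
      fun u hu =>
        (tendsto_comap.prodMap tendsto_comap).eventually (hh u hu)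
  rw [← hl, Filter.map_map] at hfx ⊢
  exact cauchy_map_of_uniformCauchySeqOn_fderiv hΩ hc hA (fun i z hz => (i.2 z hz).hasFDerivAt)
    hx hy hfx

theorem exists_ball_tendstoUniformlyOn_and_hasDerivAt (hΩ : IsOpen Ω) {f h : ι → ℂ → F} {g : ℂ → F}
    (hlim : TendstoLocallyUniformlyOn h g l Ω) {z : ℂ} (hz : z ∈ Ω)
    (hf : ∀ᶠ x in l ×ˢ 𝓝 z, HasDerivAt (f x.1) (h x.1 x.2) x.2) :
    ∃ r > 0, Metric.ball z r ⊆ Ω ∧ TendstoUniformlyOn h g l (Metric.ball z r) ∧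
      ∀ᶠ i in l, ∀ y ∈ Metric.ball z r, HasDerivAt (f i) (h i y) y := by
  obtain ⟨p, hp, q, hq, hpq⟩ := eventually_prod_iff.1 hf
  obtain ⟨r, hr, hball⟩ := Metric.nhds_basis_closedBall.mem_iff.1 (inter_mem (hΩ.mem_nhds hz) hq)
  refine ⟨r, hr, fun y hy => (hball (Metric.ball_subset_closedBall hy)).1, ?_,
    hp.mono fun i hi y hy => hpq hi (hball (Metric.ball_subset_closedBall hy)).2⟩
  exact ((tendstoLocallyUniformlyOn_iff_forall_isCompact hΩ).1 hlim _
    (fun y hy => (hball hy).1) (isCompact_closedBall z r)).mono Metric.ball_subset_closedBall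

theorem cauchy_map_of_tendstoLocallyUniformlyOn_deriv [l.NeBot] (hΩ : IsOpen Ω)
    (hc : IsPreconnected Ω) {f h : ι → ℂ → F} {g : ℂ → F}
    (hlim : TendstoLocallyUniformlyOn h g l Ω)
    (hf : ∀ z ∈ Ω, ∀ᶠ x in l ×ˢ 𝓝 z, HasDerivAt (f x.1) (h x.1 x.2) x.2) {z₀ z : ℂ} (hz₀ : z₀ ∈ Ω)
    (hz : z ∈ Ω) : Cauchy (map (fun i => f i z₀) l) → Cauchy (map (fun i => f i z) l) := by
  refine hc.induction₂' (fun x y => Cauchy (map (fun i => f i x) l) →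
    Cauchy (map (fun i => f i y) l)) (fun x hx => ?_)
    (fun _ _ _ _ _ _ hxy hyz => hyz ∘ hxy) hz₀ hz
  obtain ⟨r, hr, -, hu, hder⟩ :=
    exists_ball_tendstoUniformlyOn_and_hasDerivAt hΩ hlim hx (hf x hx)
  have hstep {a b : ℂ} := cauchy_map_of_uniformCauchySeqOn_deriv (x := a) (y := b)
    Metric.isOpen_ball (convex_ball x r).isPreconnected hu.uniformCauchySeqOn hder
  have hxr := Metric.mem_ball_self (x := x) hr
  filter_upwards [nhdsWithin_le_nhds (Metric.ball_mem_nhds x hr)] with y hy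
  exact ⟨hstep hxr hy, hstep hy hxr⟩

theorem isExactOn_of_tendstoLocallyUniformlyOn [CompleteSpace F] [l.NeBot] (hΩ : IsOpen Ω)
    (hc : IsPreconnected Ω) {f h : ι → ℂ → F} {g : ℂ → F}
    (hlim : TendstoLocallyUniformlyOn h g l Ω)
    (hf : ∀ z ∈ Ω, ∀ᶠ x in l ×ˢ 𝓝 z, HasDerivAt (f x.1) (h x.1 x.2) x.2) :
    Complex.IsExactOn g Ω := by
  rcases Ω.eq_empty_or_nonempty with rfl | ⟨z₀, hz₀⟩
  · exact ⟨0, by simp⟩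
  let φ : ι → ℂ → F := fun i y => f i y - f i z₀
  have hφ (z : ℂ) (hz : z ∈ Ω) :
      ∀ᶠ x in l ×ˢ 𝓝 z, HasDerivAt (φ x.1) (h x.1 x.2) x.2 :=
    (hf z hz).mono fun x hx => hx.sub_const _
  have hexists (z : ℂ) : ∃ c, z ∈ Ω → Tendsto (fun i => φ i z) l (𝓝 c) := by
    by_cases hz : z ∈ Ω
    · have hcauchy := cauchy_map_of_tendstoLocallyUniformlyOn_deriv hΩ hc hlim hφ hz₀ hz
        (by simpa only [φ, sub_self] using (tendsto_const_nhds (x := (0 : F))).cauchy_map)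
      exact (cauchy_map_iff_exists_tendsto.1 hcauchy).imp fun _ hc _ => hc
    · exact ⟨0, fun h => absurd h hz⟩
  choose G hG using hexists
  refine ⟨G, fun z hz => ?_⟩
  obtain ⟨r, hr, hsub, -, hder⟩ :=
    exists_ball_tendstoUniformlyOn_and_hasDerivAt hΩ hlim hz (hφ z hz)
  exact hasDerivAt_of_tendstoLocallyUniformlyOn Metric.isOpen_ball (hlim.mono hsub) hder
    (fun x hx => hG x (hsub hx)) (Metric.mem_ball_self hr)

end Primitives

section JointLimits

variable {ι X Y : Type*} {l : Filter ι} {F : ι → X → Y}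

theorem tendstoLocallyUniformlyOn_of_forall_tendsto_prod [TopologicalSpace X]
    [PseudoMetricSpace Y] {f : X → Y} {U : Set X} (hf : ContinuousOn f U)
    (h : ∀ p ∈ U, Tendsto (fun x : ι × X => F x.1 x.2) (l ×ˢ 𝓝 p) (𝓝 (f p))) :
    TendstoLocallyUniformlyOn F f l U := by
  rw [tendstoLocallyUniformlyOn_iff_forall_tendsto]
  intro p hp
  have hlim : Tendsto (fun x : ι × X => f x.2) (l ×ˢ 𝓝[U] p) (𝓝 (f p)) :=
    (hf p hp).tendsto.comp tendsto_snd
  have happrox : Tendsto (fun x : ι × X => F x.1 x.2) (l ×ˢ 𝓝[U] p) (𝓝 (f p)) :=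
    (h p hp).mono_left (Filter.prod_mono le_rfl nhdsWithin_le_nhds)
  exact (hlim.prodMk_nhds happrox).mono_right (nhds_le_uniformity _)

theorem tendsto_prod_of_tendstoLocallyUniformlyOn [TopologicalSpace X] [UniformSpace Y]
    {f : X → Y} {U : Set X} (hU : IsOpen U) (hf : ContinuousOn f U)
    (h : TendstoLocallyUniformlyOn F f l U) {p : X} (hp : p ∈ U) :
    Tendsto (fun x : ι × X => F x.1 x.2) (l ×ˢ 𝓝 p) (𝓝 (f p)) :=
  ((hf.continuousAt (hU.mem_nhds hp)).tendsto.comp tendsto_snd).congr_uniformity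
    (hU.tendstoLocallyUniformlyOn_iff_forall_tendsto.1 h p hp)

theorem tendsto_prod_nhds_of_dist_le_mul_dist [PseudoMetricSpace X] [PseudoMetricSpace Y] {p : X}
    {y : Y} (C : ℝ) (hp : Tendsto (fun i => F i p) l (𝓝 y))
    (hF : ∀ᶠ x : ι × X in l ×ˢ 𝓝 p, dist (F x.1 x.2) (F x.1 p) ≤ C * dist x.2 p) :
    Tendsto (fun x : ι × X => F x.1 x.2) (l ×ˢ 𝓝 p) (𝓝 y) := by
  rw [tendsto_iff_dist_tendsto_zero] at hp ⊢
  have hdist : Tendsto (fun x : ι × X => dist x.2 p) (l ×ˢ 𝓝 p) (𝓝 0) :=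
    (tendsto_iff_dist_tendsto_zero.1 tendsto_id).comp tendsto_snd
  have hbound : Tendsto (fun x : ι × X => C * dist x.2 p + dist (F x.1 p) y) (l ×ˢ 𝓝 p) (𝓝 0) := by
    simpa using (hdist.const_mul C).add (hp.comp tendsto_fst)
  refine squeeze_zero' (Eventually.of_forall fun _ => dist_nonneg) ?_ hbound
  filter_upwards [hF] with x hx
  exact (dist_triangle _ (F x.1 p) _).trans (by gcongr)

theorem tendsto_deriv_prod_of_forall_tendsto_prod [l.NeBot] [TopologicalSpace X] {U : Set ℂ}
    (hU : IsOpen U) {F : ι → ℂ → X → ℂ} {f : ℂ → ℂ} {w : X} (hf : DifferentiableOn ℂ f U)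
    (hF : ∀ᶠ y in l ×ˢ 𝓝 w, DifferentiableOn ℂ (fun z => F y.1 z y.2) U)
    (h : ∀ z ∈ U, Tendsto (fun x : ι × (ℂ × X) => F x.1 x.2.1 x.2.2) (l ×ˢ 𝓝 (z, w)) (𝓝 (f z)))
    {z : ℂ} (hz : z ∈ U) :
    Tendsto (fun x : ι × (ℂ × X) => deriv (fun z => F x.1 z x.2.2) x.2.1) (l ×ˢ 𝓝 (z, w))
      (𝓝 (deriv f z)) := by
  have hassoc (z : ℂ) : Tendsto (fun x : (ι × X) × ℂ => (x.1.1, (x.2, x.1.2)))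
      ((l ×ˢ 𝓝 w) ×ˢ 𝓝 z) (l ×ˢ 𝓝 (z, w)) := by
    rw [nhds_prod_eq]
    exact (tendsto_fst.comp tendsto_fst).prodMk (tendsto_snd.prodMk (tendsto_snd.comp tendsto_fst))
  have hassoc' : Tendsto (fun x : ι × (ℂ × X) => ((x.1, x.2.2), x.2.1)) (l ×ˢ 𝓝 (z, w))
      ((l ×ˢ 𝓝 w) ×ˢ 𝓝 z) := by
    rw [nhds_prod_eq]
    exact (tendsto_fst.prodMk (tendsto_snd.comp tendsto_snd)).prodMk (tendsto_fst.comp tendsto_snd)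
  have hlim : TendstoLocallyUniformlyOn (fun (y : ι × X) z => F y.1 z y.2) f (l ×ˢ 𝓝 w) U :=
    tendstoLocallyUniformlyOn_of_forall_tendsto_prod hf.continuousOn fun z hz =>
      (h z hz).comp (hassoc z)
  exact (tendsto_prod_of_tendstoLocallyUniformlyOn hU (hf.deriv hU).continuousOn (hlim.deriv hF hU)
    hz).comp hassoc'

end JointLimits

section UniformEstimates

variable {ι X : Type*} {l : Filter ι}

theorem tendstoUniformlyOn_of_sq_norm_sub_le {E : Type*} [SeminormedAddCommGroup E] {s : Set X}
    {F : ι → X → E} {f : X → E} {b : ι → ℝ} (hb : Tendsto b l (𝓝 0))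
    (hF : ∀ᶠ i in l, ∀ x ∈ s, ‖F i x - f x‖ ^ 2 ≤ b i) : TendstoUniformlyOn F f l s := by
  rw [Metric.tendstoUniformlyOn_iff]
  intro ε hε
  filter_upwards [hF, hb.eventually (gt_mem_nhds (pow_pos hε 2))] with i hi hbi x hx
  rw [dist_comm, dist_eq_norm]
  exact lt_of_pow_lt_pow_left₀ 2 hε.le ((hi x hx).trans_lt hbi)

theorem uniformCauchySeqOn_of_sq_norm_sub_le {E : Type*} [SeminormedAddCommGroup E] [l.NeBot]
    {s : Set X} {F : ι → X → E} {b : ι → ℝ} (hb : Tendsto b l (𝓝 0))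
    (hF : ∀ᶠ i in l, ∀ᶠ j in l, ∀ x ∈ s, ‖F i x - F j x‖ ^ 2 ≤ b i) :
    UniformCauchySeqOn F l s := by
  intro u hu
  obtain ⟨ε, hε, hεu⟩ := Metric.mem_uniformity_dist.1 hu
  obtain ⟨i, hi, hbi⟩ :=
    (hF.and (hb.eventually (gt_mem_nhds (pow_pos (half_pos hε) 2)))).exists
  have hclose : ∀ᶠ j in l, ∀ x ∈ s, dist (F i x) (F j x) < ε / 2 := hi.mono fun j hj x hx => by
    rw [dist_eq_norm]
    exact lt_of_pow_lt_pow_left₀ 2 (half_pos hε).le ((hj x hx).trans_lt hbi)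
  filter_upwards [prod_mem_prod hclose hclose] with j hj x hx
  exact hεu (dist_triangle_left _ _ (F i x) |>.trans_lt (by linarith [hj.1 x hx, hj.2 x hx]))

theorem exists_tendstoLocallyUniformlyOn_of_uniformCauchySeqOn {Y : Type*} [TopologicalSpace X]
    [LocallyCompactSpace X] [UniformSpace Y] [CompleteSpace Y] [Nonempty Y] [l.NeBot] {U : Set X}
    (hU : IsOpen U) {F : ι → X → Y}
    (hF : ∀ L ⊆ U, IsCompact L → UniformCauchySeqOn F l L) :
    ∃ f, TendstoLocallyUniformlyOn F f l U := by
  have hlim (x : X) : ∃ y, x ∈ U → Tendsto (fun i => F i x) l (𝓝 y) := by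
    by_cases hx : x ∈ U
    · have hcauchy := (hF {x} (Set.singleton_subset_iff.2 hx) isCompact_singleton).cauchy_map rfl
      exact (cauchy_map_iff_exists_tendsto.1 hcauchy).imp fun _ hy _ => hy
    · exact ⟨Classical.arbitrary Y, fun h => absurd h hx⟩
  choose f hf using hlim
  exact ⟨f, (tendstoLocallyUniformlyOn_iff_forall_isCompact hU).2 fun L hLU hL =>
    (hF L hLU hL).tendstoUniformlyOn_of_tendsto fun x hx => hf x (hLU hx)⟩

theorem exists_tendsto_of_eventually_eventually_le [l.NeBot] {a : ι → ℝ}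
    (hbdd : l.IsBoundedUnder (· ≥ ·) a) (ha : ∀ᶠ i in l, ∀ᶠ j in l, a j ≤ a i) :
    ∃ α, Tendsto a l (𝓝 α) ∧ ∀ᶠ i in l, α ≤ a i := by
  have hge : ∀ᶠ i in l, limsup a l ≤ a i :=
    ha.mono fun i hi => limsup_le_of_le hbdd.isCoboundedUnder_le hi
  obtain ⟨i, hi⟩ := ha.exists
  have hbdd' : l.IsBoundedUnder (· ≤ ·) a := isBoundedUnder_of_eventually_le hi
  exact ⟨limsup a l, tendsto_of_le_liminf_of_limsup_le
    (le_liminf_of_le hbdd'.isCoboundedUnder_ge hge) le_rfl hbdd' hbdd, hge⟩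

end UniformEstimates

section ClosedRange

variable {𝕜 V E G : Type*} [RCLike 𝕜] [AddCommGroup V] [Module 𝕜 V] [NormedAddCommGroup G]
  [NormedSpace 𝕜 G]

theorem exists_continuousLinearMap_range_of_norm_le [NormedAddCommGroup E] [NormedSpace 𝕜 E]
    {T : V →ₗ[𝕜] E} {ℓ : V →ₗ[𝕜] G} {C : ℝ} (hC : ∀ v, ‖ℓ v‖ ≤ C * ‖T v‖) :
    ∃ φ : T.range →L[𝕜] G, ∀ v, φ (T.rangeRestrict v) = ℓ v := by
  have hker : T.ker ≤ ℓ.ker := fun v hv => by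
    rw [LinearMap.mem_ker] at hv ⊢
    simpa [hv] using hC v
  let φ : T.range →ₗ[𝕜] G := T.ker.liftQ ℓ hker ∘ₗ T.quotKerEquivRange.symm.toLinearMap
  have hφ (v : V) : φ (T.rangeRestrict v) = ℓ v := by
    have hsymm := T.quotKerEquivRange_symm_apply_image v (LinearMap.mem_range_self T v)
    exact (congrArg (T.ker.liftQ ℓ hker) hsymm).trans (T.ker.liftQ_apply ℓ v)
  refine ⟨φ.mkContinuous C fun g => ?_, hφ⟩
  obtain ⟨v, rfl⟩ := T.surjective_rangeRestrict g
  exact (congrArg norm (hφ v)).trans_le (hC v)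

theorem exists_forall_norm_le_mul_of_pointwise_bounded [NormedAddCommGroup E] [NormedSpace 𝕜 E]
    {T : V →ₗ[𝕜] E} [CompleteSpace T.range] {ι : Type*} {ℓ : ι → V →ₗ[𝕜] G}
    (hℓ : ∀ i, ∃ C, ∀ v, ‖ℓ i v‖ ≤ C * ‖T v‖) (hbdd : ∀ v, ∃ C, ∀ i, ‖ℓ i v‖ ≤ C) :
    ∃ C, ∀ i v, ‖ℓ i v‖ ≤ C * ‖T v‖ := by
  choose C hC using hℓ
  choose φ hφ using fun i => exists_continuousLinearMap_range_of_norm_le (hC i)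
  obtain ⟨B, hB⟩ := banach_steinhaus (g := φ) fun g => by
    obtain ⟨v, rfl⟩ := T.surjective_rangeRestrict g
    simpa only [hφ] using hbdd v
  refine ⟨B, fun i v => ?_⟩
  rw [← hφ]
  exact (φ i).le_of_opNorm_le (hB i) _

theorem exists_eq_inner_of_norm_le [NormedAddCommGroup E] [InnerProductSpace 𝕜 E] {T : V →ₗ[𝕜] E}
    [CompleteSpace T.range] {ℓ : V →ₗ[𝕜] 𝕜} {C : ℝ} (hC : ∀ v, ‖ℓ v‖ ≤ C * ‖T v‖) :
    ∃ v, ∀ u, ℓ u = inner 𝕜 (T v) (T u) := by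
  obtain ⟨φ, hφ⟩ := exists_continuousLinearMap_range_of_norm_le hC
  obtain ⟨v, hv⟩ := T.surjective_rangeRestrict ((InnerProductSpace.toDual 𝕜 T.range).symm φ)
  refine ⟨v, fun u => ?_⟩
  rw [← hφ, ← InnerProductSpace.toDual_symm_apply, ← hv]
  rfl

end ClosedRange

section ContDiffConvergence

variable {ι 𝕜 E F G : Type*} [NontriviallyNormedField 𝕜] [NormedAddCommGroup E] [NormedSpace 𝕜 E]
  [NormedAddCommGroup F] [NormedSpace 𝕜 F] [NormedAddCommGroup G] [NormedSpace 𝕜 G]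
  {l : Filter ι} {p : E} {m : WithTop ℕ∞}

variable (𝕜 l) in
/-- `C^m` convergence at a point `p` of functions `u i` to `f` along `l`. Taking derivatives at
variable points, along `l ×ˢ 𝓝 p`, builds in local uniformity and makes the notion stable under
composition. -/
structure TendstoContDiffAt (m : WithTop ℕ∞) (u : ι → E → F) (f : E → F) (p : E) : Prop where
  eventually_contDiffAt : ∀ᶠ x in l ×ˢ 𝓝 p, ContDiffAt 𝕜 m (u x.1) x.2
  contDiffAt : ContDiffAt 𝕜 m f p
  tendsto_iteratedFDeriv : ∀ k : ℕ, k ≤ m →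
    Tendsto (fun x => iteratedFDeriv 𝕜 k (u x.1) x.2) (l ×ˢ 𝓝 p) (𝓝 (iteratedFDeriv 𝕜 k f p))

theorem tendsto_iteratedFDeriv_zero_iff {u : ι → E → F} {f : E → F} :
    Tendsto (fun x => iteratedFDeriv 𝕜 0 (u x.1) x.2) (l ×ˢ 𝓝 p) (𝓝 (iteratedFDeriv 𝕜 0 f p)) ↔
      Tendsto (fun x => u x.1 x.2) (l ×ˢ 𝓝 p) (𝓝 (f p)) := by
  simp only [iteratedFDeriv_zero_eq_comp, Function.comp_def]
  exact (continuousMultilinearCurryFin0 𝕜 E F).symm.isometry.isEmbedding.tendsto_nhds_iff.symm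

theorem eventually_nhds_snd_of_eventually_prod {P : ι × E → Prop} (h : ∀ᶠ x in l ×ˢ 𝓝 p, P x) :
    ∀ᶠ x in l ×ˢ 𝓝 p, ∀ᶠ q in 𝓝 x.2, P (x.1, q) := by
  obtain ⟨s, hs, t, ht, hst⟩ := eventually_prod_iff.1 h
  exact eventually_prod_iff.2
    ⟨s, hs, _, eventually_eventually_nhds.2 ht, fun hi _ hq => hq.mono fun _ => hst hi⟩

namespace TendstoContDiffAt

theorem tendsto {u : ι → E → F} {f : E → F} (h : TendstoContDiffAt 𝕜 l m u f p) :
    Tendsto (fun x => u x.1 x.2) (l ×ˢ 𝓝 p) (𝓝 (f p)) :=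
  tendsto_iteratedFDeriv_zero_iff.1 (h.tendsto_iteratedFDeriv 0 (by simp))

theorem congr {u v : ι → E → F} {f g : E → F} (h : TendstoContDiffAt 𝕜 l m u f p)
    (huv : ∀ᶠ x in l ×ˢ 𝓝 p, u x.1 x.2 = v x.1 x.2) (hfg : f =ᶠ[𝓝 p] g) :
    TendstoContDiffAt 𝕜 l m v g p := by
  have huv' : ∀ᶠ x in l ×ˢ 𝓝 p, u x.1 =ᶠ[𝓝 x.2] v x.1 := eventually_nhds_snd_of_eventually_prod huv
  refine ⟨?_, h.contDiffAt.congr_of_eventuallyEq hfg.symm, fun k hk => ?_⟩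
  · filter_upwards [h.eventually_contDiffAt, huv'] with x hx hx'
    exact hx.congr_of_eventuallyEq hx'.symm
  · rw [← (hfg.iteratedFDeriv 𝕜 k).eq_of_nhds]
    refine (h.tendsto_iteratedFDeriv k hk).congr' ?_
    filter_upwards [huv'] with x hx using (hx.iteratedFDeriv 𝕜 k).eq_of_nhds

theorem of_eventually_contDiffAt {f : E → F} (hf : ∀ᶠ q in 𝓝 p, ContDiffAt 𝕜 m f q) :
    TendstoContDiffAt 𝕜 l m (fun _ => f) f p where
  eventually_contDiffAt := tendsto_snd.eventually hf
  contDiffAt := hf.self_of_nhds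
  tendsto_iteratedFDeriv _ hk :=
    (hf.self_of_nhds.continuousAt_iteratedFDeriv hk).tendsto.comp tendsto_snd

-- Faà di Bruno: the derivatives of a composition are polynomials in those of its factors.
theorem comp {v : ι → F → G} {g : F → G} {u : ι → E → F} {f : E → F}
    (hg : TendstoContDiffAt 𝕜 l m v g (f p)) (hf : TendstoContDiffAt 𝕜 l m u f p) :
    TendstoContDiffAt 𝕜 l m (fun i => v i ∘ u i) (g ∘ f) p := by
  have hpair : Tendsto (fun x : ι × E => (x.1, u x.1 x.2)) (l ×ˢ 𝓝 p) (l ×ˢ 𝓝 (f p)) :=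
    tendsto_fst.prodMk hf.tendsto
  have hvu := hpair.eventually hg.eventually_contDiffAt
  refine ⟨?_, hg.contDiffAt.comp p hf.contDiffAt, fun k hk => ?_⟩
  · filter_upwards [hf.eventually_contDiffAt, hvu] with x hx hx' using hx'.comp x.2 hx
  · rw [iteratedFDeriv_comp hg.contDiffAt hf.contDiffAt hk]
    refine Tendsto.congr' (f₁ := fun x => (ftaylorSeries 𝕜 (v x.1) (u x.1 x.2)).taylorComp
      (ftaylorSeries 𝕜 (u x.1) x.2) k) ?_ ?_
    · filter_upwards [hf.eventually_contDiffAt, hvu] with x hx hx'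
      exact (iteratedFDeriv_comp hx' hx hk).symm
    · refine tendsto_finsetSum _ fun c _ => ?_
      have hle {a : ℕ} (ha : a ≤ k) : (a : WithTop ℕ∞) ≤ m := (Nat.cast_le.2 ha).trans hk
      have houter := (hg.tendsto_iteratedFDeriv _ (hle c.length_le)).comp hpair
      have hinner : Tendsto (fun (x : ι × E) a => iteratedFDeriv 𝕜 (c.partSize a) (u x.1) x.2)
          (l ×ˢ 𝓝 p) (𝓝 fun a => iteratedFDeriv 𝕜 (c.partSize a) f p) :=
        tendsto_pi_nhds.2 fun a => hf.tendsto_iteratedFDeriv _ (hle (c.partSize_le a))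
      have hL := ((c.compAlongOrderedFinpartitionL 𝕜 E F G).continuous.tendsto _).comp houter
      exact (continuous_eval.tendsto (_, _)).comp (hL.prodMk_nhds hinner)

theorem prodMk {u : ι → E → F} {f : E → F} {v : ι → E → G} {g : E → G}
    (hf : TendstoContDiffAt 𝕜 l m u f p) (hg : TendstoContDiffAt 𝕜 l m v g p) :
    TendstoContDiffAt 𝕜 l m (fun i x => (u i x, v i x)) (fun x => (f x, g x)) p := by
  refine ⟨?_, hf.contDiffAt.prodMk hg.contDiffAt, fun k hk => ?_⟩
  · filter_upwards [hf.eventually_contDiffAt, hg.eventually_contDiffAt] with x hx hx'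
      using hx.prodMk hx'
  · rw [iteratedFDeriv_prodMk hf.contDiffAt hg.contDiffAt hk]
    refine Tendsto.congr' ?_ (((ContinuousMultilinearMap.prodL 𝕜 (fun _ : Fin k => E) F
      G).continuous.tendsto _).comp
        ((hf.tendsto_iteratedFDeriv k hk).prodMk_nhds (hg.tendsto_iteratedFDeriv k hk)))
    filter_upwards [hf.eventually_contDiffAt, hg.eventually_contDiffAt] with x hx hx'
    exact (iteratedFDeriv_prodMk hx hx' hk).symm

theorem pi {κ : Type*} [Fintype κ] {H : κ → Type*} [∀ a, NormedAddCommGroup (H a)]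
    [∀ a, NormedSpace 𝕜 (H a)] {u : ι → E → ∀ a, H a} {f : E → ∀ a, H a}
    (h : ∀ a, TendstoContDiffAt 𝕜 l m (fun i x => u i x a) (fun x => f x a) p) :
    TendstoContDiffAt 𝕜 l m u f p := by
  have hcd : ∀ᶠ x in l ×ˢ 𝓝 p, ContDiffAt 𝕜 m (u x.1) x.2 := by
    filter_upwards [eventually_all.2 fun a => (h a).eventually_contDiffAt] with x hx
      using contDiffAt_pi.2 hx
  have hf : ContDiffAt 𝕜 m f p := contDiffAt_pi.2 fun a => (h a).contDiffAt
  refine ⟨hcd, hf, fun k hk => ?_⟩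
  have hpi {w : E → ∀ a, H a} {x : E} (hw : ContDiffAt 𝕜 m w x) : iteratedFDeriv 𝕜 k w x =
      ContinuousMultilinearMap.pi fun a => iteratedFDeriv 𝕜 k (fun y => w y a) x := by
    ext v a
    change _ = iteratedFDeriv 𝕜 k (ContinuousLinearMap.proj (R := 𝕜) (φ := H) a ∘ w) x v
    rw [ContinuousLinearMap.iteratedFDeriv_comp_left _ hw hk]
    rfl
  rw [hpi hf]
  refine Tendsto.congr' ?_ (((ContinuousMultilinearMap.piₗᵢ 𝕜
    (fun _ : Fin k => E)).continuous.tendsto _).comp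
      (tendsto_pi_nhds.2 fun a => (h a).tendsto_iteratedFDeriv k hk))
  filter_upwards [hcd] with x hx using (hpi hx).symm

theorem of_continuousAt {u : ι → E → F} {f : E → F}
    (hlim : Tendsto (fun x => u x.1 x.2) (l ×ˢ 𝓝 p) (𝓝 (f p)))
    (hu : ∀ᶠ x in l ×ˢ 𝓝 p, ContinuousAt (u x.1) x.2) (hf : ∀ᶠ q in 𝓝 p, ContinuousAt f q) :
    TendstoContDiffAt 𝕜 l 0 u f p := by
  refine ⟨?_, contDiffAt_zero.2 ⟨_, hf, fun _ hq => hq.continuousWithinAt⟩, fun k hk => ?_⟩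
  · filter_upwards [eventually_nhds_snd_of_eventually_prod hu] with x hx
    exact contDiffAt_zero.2 ⟨_, hx, fun _ hq => hq.continuousWithinAt⟩
  · obtain rfl : k = 0 := by simpa using hk
    exact tendsto_iteratedFDeriv_zero_iff.2 hlim

theorem succ {m : ℕ} {u : ι → E → F} {f : E → F} {u' : ι → E → E →L[𝕜] F} {f' : E → E →L[𝕜] F}
    (hu : Tendsto (fun x => u x.1 x.2) (l ×ˢ 𝓝 p) (𝓝 (f p)))
    (hu' : ∀ᶠ x in l ×ˢ 𝓝 p, HasFDerivAt (u x.1) (u' x.1 x.2) x.2)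
    (hf' : ∀ᶠ q in 𝓝 p, HasFDerivAt f (f' q) q)
    (h : TendstoContDiffAt 𝕜 l m u' f' p) : TendstoContDiffAt 𝕜 l (m + 1) u f p := by
  have hfderiv := h.congr (v := fun i => fderiv 𝕜 (u i)) (hu'.mono fun _ hx => hx.fderiv.symm)
    (hf'.mono fun _ hq => hq.fderiv.symm)
  refine ⟨?_, ?_, fun k hk => ?_⟩
  · filter_upwards [h.eventually_contDiffAt, eventually_nhds_snd_of_eventually_prod hu']
      with x hx hx'
    exact contDiffAt_succ_iff_hasFDerivAt.2 ⟨u' x.1, ⟨_, hx', fun _ hq => hq⟩, hx⟩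
  · exact contDiffAt_succ_iff_hasFDerivAt.2 ⟨f', ⟨_, hf', fun _ hq => hq⟩, h.contDiffAt⟩
  · cases k with
    | zero => exact tendsto_iteratedFDeriv_zero_iff.2 hu
    | succ k =>
      have hkm : k + 1 ≤ m + 1 := mod_cast hk
      simp only [iteratedFDeriv_succ_eq_comp_right]
      exact ((continuousMultilinearCurryRightEquiv' 𝕜 k E F).symm.continuous.tendsto _).comp
        (hfderiv.tendsto_iteratedFDeriv k (mod_cast Nat.le_of_succ_le_succ hkm))

theorem of_forall_nat {u : ι → E → F} {f : E → F}
    (hu : ∀ᶠ x in l ×ˢ 𝓝 p, ContDiffAt 𝕜 ∞ (u x.1) x.2)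
    (h : ∀ m : ℕ, TendstoContDiffAt 𝕜 l m u f p) : TendstoContDiffAt 𝕜 l ∞ u f p :=
  ⟨hu, contDiffAt_infty.2 fun m => (h m).contDiffAt,
    fun k _ => (h k).tendsto_iteratedFDeriv k le_rfl⟩

end TendstoContDiffAt

theorem allDerivsTendstoLocallyUniformlyOn_of_forall_tendstoContDiffAt {F : ℕ → ℂ × ℂ → ℂ}
    {f : ℂ × ℂ → ℂ} {U : Set (ℂ × ℂ)} (h : ∀ p ∈ U, TendstoContDiffAt ℝ atTop ∞ F f p) :
    AllDerivsTendstoLocallyUniformlyOn F f U := by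
  have hle (m : ℕ) : (m : WithTop ℕ∞) ≤ ∞ := mod_cast le_top
  refine ⟨fun p hp => (h p hp).contDiffAt, fun L hLU hL => ?_, fun m => ?_⟩
  · have hmem : {x : ℕ × (ℂ × ℂ) | ContDiffAt ℝ ∞ (F x.1) x.2} ∈ atTop ×ˢ 𝓝ˢ L :=
      hL.mem_prod_nhdsSet_of_forall fun p hp => (h p (hLU hp)).eventually_contDiffAt
    obtain ⟨s, hs, t, ht, hst⟩ := eventually_prod_iff.1 hmem
    exact hs.mono fun i hi p hp => hst hi (subset_of_mem_nhdsSet ht hp)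
  · exact tendstoLocallyUniformlyOn_of_forall_tendsto_prod
      (fun p hp => ((h p hp).contDiffAt.continuousAt_iteratedFDeriv (hle m)).continuousWithinAt)
      (fun p hp => (h p hp).tendsto_iteratedFDeriv m (hle m))

end ContDiffConvergence

section L2Pairing

variable {α : Type*} [MeasurableSpace α] {m : Measure α} {f g : α → ℂ}

/-- The `L²` pairing `∫ f conj(g) dm` of functions, which is linear in the first variable as in
the definition of the kernel functions. -/
noncomputable def l2Inner (m : Measure α) (f g : α → ℂ) : ℂ :=
  ∫ z, f z * conj (g z) ∂m

/-- The square `∫ |f|² dm` of the `L²` seminorm of a function. -/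
noncomputable def l2NormSq (m : Measure α) (f : α → ℂ) : ℝ :=
  ∫ z, ‖f z‖ ^ 2 ∂m

theorem l2Inner_eq_inner (hf : MemLp f 2 m) (hg : MemLp g 2 m) :
    l2Inner m f g = inner ℂ hg.toLp hf.toLp := by
  rw [L2.inner_def, l2Inner]
  refine integral_congr_ae ?_
  filter_upwards [hf.coeFn_toLp, hg.coeFn_toLp] with z hfz hgz
  rw [hfz, hgz, RCLike.inner_apply]

theorem l2Inner_self (f : α → ℂ) : l2Inner m f f = (l2NormSq m f : ℂ) := by
  rw [l2Inner, l2NormSq, ← integral_complex_ofReal]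
  refine integral_congr_ae (Eventually.of_forall fun z => ?_)
  simp [Complex.mul_conj, Complex.normSq_eq_norm_sq]

theorem l2NormSq_eq_norm_sq (hf : MemLp f 2 m) : l2NormSq m f = ‖hf.toLp‖ ^ 2 := by
  have h := l2Inner_self (m := m) f
  rw [l2Inner_eq_inner hf hf, inner_self_eq_norm_sq_to_K] at h
  exact Complex.ofReal_injective (h.symm.trans (by simp))

theorem l2NormSq_nonneg (f : α → ℂ) : 0 ≤ l2NormSq m f :=
  integral_nonneg fun _ => by positivity

theorem conj_l2Inner (f g : α → ℂ) : conj (l2Inner m f g) = l2Inner m g f := by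
  rw [l2Inner, l2Inner, ← integral_conj]
  simp only [map_mul, Complex.conj_conj, mul_comm]

theorem l2NormSq_sub (hf : MemLp f 2 m) (hg : MemLp g 2 m) :
    l2NormSq m (f - g) = l2NormSq m f - 2 * (l2Inner m f g).re + l2NormSq m g := by
  rw [l2NormSq_eq_norm_sq (hf.sub hg), l2NormSq_eq_norm_sq hf, l2NormSq_eq_norm_sq hg,
    l2Inner_eq_inner hf hg, MemLp.toLp_sub, @norm_sub_sq ℂ, inner_re_symm]
  rfl

theorem l2Inner_sum_smul_right {ι : Type*} (s : Finset ι) (c : ι → ℂ) {e : ι → α → ℂ}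
    (hf : MemLp f 2 m) (he : ∀ i ∈ s, MemLp (e i) 2 m) :
    l2Inner m f (∑ i ∈ s, c i • e i) = ∑ i ∈ s, conj (c i) * l2Inner m f (e i) := by
  have hint : ∀ i ∈ s, Integrable (fun z => conj (c i) * (f z * conj (e i z))) m :=
    fun i hi => (hf.integrable_mul (he i hi).star).const_mul _
  simp only [l2Inner, ← integral_const_mul]
  rw [← integral_finsetSum s hint]
  simp only [Finset.sum_apply, Pi.smul_apply, smul_eq_mul, map_sum, map_mul, Finset.mul_sum]
  simp only [mul_left_comm]

theorem l2NormSq_mono {m' : Measure α} (h : m ≤ m') (hf : MemLp f 2 m') :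
    l2NormSq m f ≤ l2NormSq m' f :=
  integral_mono_measure h (Eventually.of_forall fun _ => by positivity)
    (by simpa using hf.integrable_norm_pow two_ne_zero)

theorem lintegral_enorm_sq_eq_ofReal_l2NormSq (hf : MemLp f 2 m) :
    ∫⁻ z, ‖f z‖ₑ ^ 2 ∂m = ENNReal.ofReal (l2NormSq m f) := by
  rw [l2NormSq, ofReal_integral_eq_lintegral_ofReal
    (by simpa using hf.integrable_norm_pow two_ne_zero)
    (Eventually.of_forall fun z => sq_nonneg _)]
  refine lintegral_congr fun z => ?_
  rw [ENNReal.ofReal_pow (norm_nonneg _), ofReal_norm]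

theorem memLp_two_of_lintegral_enorm_sq_lt_top (hf : AEStronglyMeasurable f m)
    (hlt : ∫⁻ z, ‖f z‖ₑ ^ 2 ∂m < ⊤) : MemLp f 2 m := by
  refine ⟨hf, ?_⟩
  rw [eLpNorm_lt_top_iff_lintegral_rpow_enorm_lt_top two_ne_zero ENNReal.ofNat_ne_top]
  simpa using hlt

/-- The class map from a space `S` of square integrable functions to `L²(m)`. -/
noncomputable def toLpLinear (m : Measure α) (S : Submodule ℂ (α → ℂ)) (hS : ∀ f ∈ S, MemLp f 2 m) :
    S →ₗ[ℂ] Lp ℂ 2 m where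
  toFun f := (hS f f.2).toLp
  map_add' _ _ := rfl
  map_smul' _ _ := rfl

theorem norm_toLpLinear {S : Submodule ℂ (α → ℂ)} (hS : ∀ f ∈ S, MemLp f 2 m) (f : S) :
    ‖toLpLinear m S hS f‖ = (eLpNorm (f : α → ℂ) 2 m).toReal :=
  Lp.norm_toLp _ (hS f f.2)

theorem mem_range_toLpLinear {S : Submodule ℂ (α → ℂ)} (hS : ∀ f ∈ S, MemLp f 2 m)
    {G : Lp ℂ 2 m} : G ∈ (toLpLinear m S hS).range ↔ ∃ f ∈ S, G =ᵐ[m] f :=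
  ⟨fun ⟨f, hf⟩ => ⟨f, f.2, hf ▸ (hS f f.2).coeFn_toLp⟩,
    fun ⟨f, hf, hG⟩ => ⟨⟨f, hf⟩, Lp.ext ((hS f hf).coeFn_toLp.trans hG.symm)⟩⟩

end L2Pairing

section FunctionSpaces

variable {D : Set ℂ} {μ : ℂ → ℝ}

/-- The weighted Bergman space `A²_μ(D)`, consisting of functions on the whole plane whose values
outside `D` are arbitrary. -/
def bergmanSpace (D : Set ℂ) (μ : ℂ → ℝ) : Submodule ℂ (ℂ → ℂ) where
  carrier := {h | MemBergman D μ h}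
  add_mem' := fun hf hg => ⟨hf.1.add hg.1, hf.2.add hg.2⟩
  zero_mem' := ⟨differentiableOn_const 0, MemLp.zero⟩
  smul_mem' := fun c _ hf => ⟨hf.1.const_smul c, hf.2.const_smul c⟩

/-- The reduced weighted Bergman space: the functions that are square integrable on `D` and are the
derivatives of the functions holomorphic on `D`. -/
def reducedSpace (D : Set ℂ) (μ : ℂ → ℝ) : Submodule ℂ (ℂ → ℂ) where
  carrier := {h | Complex.IsExactOn h D ∧ MemLp h 2 (weightedArea D μ)}
  add_mem' := fun ⟨⟨p, hp⟩, hf⟩ ⟨⟨q, hq⟩, hg⟩ =>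
    ⟨⟨p + q, fun z hz => (hp z hz).add (hq z hz)⟩, hf.add hg⟩
  zero_mem' := ⟨⟨0, fun z _ => hasDerivAt_const z 0⟩, MemLp.zero⟩
  smul_mem' := fun c _ ⟨⟨p, hp⟩, hf⟩ =>
    ⟨⟨c • p, fun z hz => (hp z hz).const_smul c⟩, hf.const_smul c⟩

/-- `C` bounds the squared norms of the evaluations of the reduced weighted Bergman space at the
points of `L`. -/
structure EvalBoundOn (D : Set ℂ) (μ : ℂ → ℝ) (L : Set ℂ) (C : ℝ) : Prop where
  nonneg : 0 ≤ C
  sq_norm_le : ∀ h ∈ reducedSpace D μ, ∀ z ∈ L,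
    ‖h z‖ ^ 2 ≤ C * l2NormSq (weightedArea D μ) h

/-- The functions analytic at `ζ` that vanish there to order `m`. -/
def vanishingAt (m : ℕ) (ζ : ℂ) : Submodule ℂ (ℂ → ℂ) where
  carrier := {h | AnalyticAt ℂ h ζ ∧ ∀ k < m, iteratedDeriv k h ζ = 0}
  add_mem' := fun ⟨hf, hf0⟩ ⟨hg, hg0⟩ => ⟨hf.add hg, fun k hk => by
    rw [iteratedDeriv_add hf.contDiffAt hg.contDiffAt, hf0 k hk, hg0 k hk, add_zero]⟩
  zero_mem' := ⟨analyticAt_const, fun k _ => by simp⟩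
  smul_mem' := fun c _ ⟨hf, hf0⟩ => ⟨hf.const_smul, fun k hk => by
    rw [iteratedDeriv_const_smul hf.contDiffAt, hf0 k hk, smul_zero]⟩

/-- The evaluation of the `n`-th derivative at `ζ`, as a linear functional. -/
noncomputable def iteratedDerivEval (m n : ℕ) (ζ : ℂ) : vanishingAt m ζ →ₗ[ℂ] ℂ where
  toFun h := iteratedDeriv n h ζ
  map_add' f g := iteratedDeriv_add f.2.1.contDiffAt g.2.1.contDiffAt
  map_smul' c f := iteratedDeriv_const_smul f.2.1.contDiffAt c

/-- The functions of the reduced weighted Bergman space that vanish to order `m` at `ζ`. -/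
def vanishingReducedSpace (D : Set ℂ) (μ : ℂ → ℝ) (m : ℕ) (ζ : ℂ) : Submodule ℂ (ℂ → ℂ) :=
  reducedSpace D μ ⊓ vanishingAt m ζ

theorem reducedSpace_le_bergmanSpace (hD : IsOpen D) : reducedSpace D μ ≤ bergmanSpace D μ :=
  fun _ hh => ⟨hh.1.differentiableOn hD, hh.2⟩

theorem mem_vanishingReducedSpace (hD : IsOpen D) {ζ : ℂ} (hζ : ζ ∈ D) {m : ℕ} {h : ℂ → ℂ} :
    h ∈ vanishingReducedSpace D μ m ζ ↔
      h ∈ reducedSpace D μ ∧ ∀ k < m, iteratedDeriv k h ζ = 0 :=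
  ⟨fun hh => ⟨hh.1, hh.2.2⟩, fun hh =>
    ⟨hh.1, (hh.1.1.differentiableOn hD).analyticAt (hD.mem_nhds hζ), hh.2⟩⟩

theorem IsAdmissibleWeight.exists_norm_le_mul_eLpNorm (hμ : IsAdmissibleWeight D μ) {L : Set ℂ}
    (hL : IsCompact L) (hLD : L ⊆ D) :
    ∃ C : ℝ, ∀ h ∈ bergmanSpace D μ, ∀ z ∈ L,
      ‖h z‖ ≤ C * (eLpNorm h 2 (weightedArea D μ)).toReal := by
  let T := toLpLinear (weightedArea D μ) (bergmanSpace D μ) fun _ hf => hf.2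
  have hT (h : bergmanSpace D μ) : ‖T h‖ = (eLpNorm (h : ℂ → ℂ) 2 (weightedArea D μ)).toReal :=
    norm_toLpLinear _ h
  have hrange : (T.range : Set (Lp ℂ 2 (weightedArea D μ))) =
      {g : Lp ℂ 2 (weightedArea D μ) | ∃ f, MemBergman D μ f ∧ g =ᵐ[weightedArea D μ] f} :=
    Set.ext fun _ => mem_range_toLpLinear _
  have hclosed : IsClosed (T.range : Set (Lp ℂ 2 (weightedArea D μ))) := by
    rw [hrange]; exact hμ.closed
  have : CompleteSpace T.range := hclosed.completeSpace_coe
  let eval (z : L) : bergmanSpace D μ →ₗ[ℂ] ℂ := LinearMap.proj z.1 ∘ₗ (bergmanSpace D μ).subtype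
  obtain ⟨C, hC⟩ := exists_forall_norm_le_mul_of_pointwise_bounded (T := T) (ℓ := eval)
    (fun z => by
      simp only [hT]
      exact (hμ.eval_bounded z (hLD z.2)).imp fun C hC h => hC h h.2)
    (fun h => (hL.exists_bound_of_continuousOn (h.2.1.continuousOn.mono hLD)).imp
      fun C hC z => hC z z.2)
  exact ⟨C, fun h hh z hz => (hC ⟨z, hz⟩ ⟨h, hh⟩).trans_eq (by rw [hT])⟩

theorem IsAdmissibleWeight.exists_evalBoundOn (hμ : IsAdmissibleWeight D μ) (hD : IsOpen D)
    {L : Set ℂ} (hL : IsCompact L) (hLD : L ⊆ D) : ∃ C, EvalBoundOn D μ L C := by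
  obtain ⟨C, hC⟩ := hμ.exists_norm_le_mul_eLpNorm hL hLD
  refine ⟨C ^ 2, sq_nonneg C, fun h hh z hz => ?_⟩
  rw [l2NormSq_eq_norm_sq hh.2, Lp.norm_toLp, ← mul_pow]
  exact pow_le_pow_left₀ (norm_nonneg _) (hC h (reducedSpace_le_bergmanSpace hD hh) z hz) 2

theorem IsAdmissibleWeight.exists_norm_iteratedDeriv_le_mul_eLpNorm (hμ : IsAdmissibleWeight D μ)
    (hD : IsOpen D) {ζ : ℂ} (hζ : ζ ∈ D) (k : ℕ) :
    ∃ C : ℝ, ∀ h ∈ bergmanSpace D μ,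
      ‖iteratedDeriv k h ζ‖ ≤ C * (eLpNorm h 2 (weightedArea D μ)).toReal := by
  obtain ⟨r, hr, hball⟩ := Metric.nhds_basis_closedBall.mem_iff.1 (hD.mem_nhds hζ)
  obtain ⟨C, hC⟩ := hμ.exists_norm_le_mul_eLpNorm (isCompact_closedBall ζ r) hball
  refine ⟨k.factorial * C / r ^ k, fun h hh => ?_⟩
  refine (Complex.norm_iteratedDeriv_le_of_forall_mem_sphere_norm_le k hr
    (hh.1.diffContOnCl_ball hball)
    (fun z hz => hC h hh z (Metric.sphere_subset_closedBall hz))).trans (le_of_eq ?_)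
  ring

theorem IsAdmissibleWeight.tendstoLocallyUniformlyOn (hμ : IsAdmissibleWeight D μ)
    (hD : IsOpen D) {ι : Type*} {l : Filter ι} {F : ι → ℂ → ℂ} {f : ℂ → ℂ}
    (hF : ∀ i, F i ∈ bergmanSpace D μ) (hf : f ∈ bergmanSpace D μ)
    (hlim : Tendsto (fun i => eLpNorm (F i - f) 2 (weightedArea D μ)) l (𝓝 0)) :
    TendstoLocallyUniformlyOn F f l D := by
  rw [tendstoLocallyUniformlyOn_iff_forall_isCompact hD]
  intro L hLD hL
  obtain ⟨C, hC⟩ := hμ.exists_norm_le_mul_eLpNorm hL hLD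
  rw [Metric.tendstoUniformlyOn_iff]
  intro ε hε
  have hbound : Tendsto (fun i => C * (eLpNorm (F i - f) 2 (weightedArea D μ)).toReal) l (𝓝 0) := by
    simpa using ((ENNReal.tendsto_toReal ENNReal.zero_ne_top).comp hlim).const_mul C
  filter_upwards [hbound.eventually (gt_mem_nhds hε)] with i hi z hz
  rw [dist_comm, dist_eq_norm]
  exact (hC (F i - f) (sub_mem (hF i) hf) z hz).trans_lt hi

theorem IsAdmissibleWeight.isClosed_range_vanishingReducedSpace (hμ : IsAdmissibleWeight D μ)
    (hD : IsOpen D) (hc : IsPreconnected D) {ζ : ℂ} (hζ : ζ ∈ D) (m : ℕ) :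
    IsClosed ((toLpLinear (weightedArea D μ) (vanishingReducedSpace D μ m ζ)
      fun _ hf => hf.1.2).range : Set (Lp ℂ 2 (weightedArea D μ))) := by
  refine IsSeqClosed.isClosed fun g G hg hG => ?_
  simp only [SetLike.mem_coe, mem_range_toLpLinear] at hg ⊢
  choose f hf hgf using hg
  have hfB (i : ℕ) : f i ∈ bergmanSpace D μ := reducedSpace_le_bergmanSpace hD (hf i).1
  obtain ⟨F, hF, hGF⟩ := hμ.closed.mem_of_tendsto hG
    (Eventually.of_forall fun i => ⟨f i, hfB i, hgf i⟩)
  have hlim : TendstoLocallyUniformlyOn f F atTop D :=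
    hμ.tendstoLocallyUniformlyOn hD hfB hF <|
      ((Lp.tendsto_Lp_iff_tendsto_eLpNorm' g G).1 hG).congr fun i =>
        eLpNorm_congr_ae ((hgf i).sub hGF)
  choose p hp using fun i => (hf i).1.1
  have hexact : Complex.IsExactOn F D :=
    isExactOn_of_tendstoLocallyUniformlyOn hD hc (f := p) hlim fun z hz =>
      (tendsto_snd.eventually (hD.mem_nhds hz)).mono fun x hx => hp x.1 x.2 hx
  refine ⟨F, (mem_vanishingReducedSpace hD hζ).2 ⟨⟨hexact, hF.2⟩, fun k hk => ?_⟩, hGF⟩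
  have hderiv := (tendstoLocallyUniformlyOn_iteratedDeriv hD hlim
    (Eventually.of_forall fun i => (hfB i).1) k).tendsto_at hζ
  exact tendsto_nhds_unique hderiv (by simp [(hf _).2.2 k hk])

end FunctionSpaces

section Representers

variable {D : Set ℂ} {μ : ℂ → ℝ} {m n : ℕ} {ζ : ℂ}

/-- A connected open set with an admissible weight, which is the setting of the theory of the
reduced kernels. -/
structure IsAdmissibleDomain (D : Set ℂ) (μ : ℂ → ℝ) : Prop where
  isOpen : IsOpen D
  isPreconnected : IsPreconnected D
  isAdmissibleWeight : IsAdmissibleWeight D μ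

/-- `κ` is the Riesz representative of `h ↦ h⁽ⁿ⁾(ζ)` on the functions of the reduced Bergman space
that vanish to order `m` at `ζ`. -/
structure IsRepresenter (D : Set ℂ) (μ : ℂ → ℝ) (m n : ℕ) (ζ : ℂ) (κ : ℂ → ℂ) : Prop where
  mem : κ ∈ vanishingReducedSpace D μ m ζ
  iteratedDeriv_eq : ∀ h ∈ vanishingReducedSpace D μ m ζ,
    iteratedDeriv n h ζ = l2Inner (weightedArea D μ) h κ

theorem IsAdmissibleDomain.exists_isRepresenter (hD : IsAdmissibleDomain D μ) (hζ : ζ ∈ D)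
    (m n : ℕ) : ∃ κ, IsRepresenter D μ m n ζ κ := by
  let S := vanishingReducedSpace D μ m ζ
  have hS : ∀ h ∈ S, MemLp h 2 (weightedArea D μ) := fun _ hh => hh.1.2
  have : CompleteSpace (toLpLinear (weightedArea D μ) S hS).range :=
    (hD.isAdmissibleWeight.isClosed_range_vanishingReducedSpace hD.isOpen hD.isPreconnected
      hζ m).completeSpace_coe
  obtain ⟨C, hC⟩ := hD.isAdmissibleWeight.exists_norm_iteratedDeriv_le_mul_eLpNorm hD.isOpen hζ n
  obtain ⟨κ, hκ⟩ := exists_eq_inner_of_norm_le (T := toLpLinear (weightedArea D μ) S hS)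
    (ℓ := iteratedDerivEval m n ζ ∘ₗ Submodule.inclusion inf_le_right) (C := C) fun h => by
      rw [norm_toLpLinear]
      exact hC h (reducedSpace_le_bergmanSpace hD.isOpen h.2.1)
  refine ⟨κ, κ.2, fun h hh => ?_⟩
  rw [l2Inner_eq_inner (hS h hh) (hS κ κ.2)]
  exact hκ ⟨h, hh⟩

theorem IsRepresenter.iteratedDeriv_self {κ : ℂ → ℂ} (hκ : IsRepresenter D μ m n ζ κ) :
    iteratedDeriv n κ ζ = l2NormSq (weightedArea D μ) κ := by
  rw [hκ.iteratedDeriv_eq κ hκ.mem, l2Inner_self]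

theorem eqOn_of_l2NormSq_sub_nonpos (hD : IsAdmissibleDomain D μ) {f g : ℂ → ℂ}
    (hf : f ∈ reducedSpace D μ) (hg : g ∈ reducedSpace D μ)
    (hfg : l2NormSq (weightedArea D μ) (f - g) ≤ 0) : Set.EqOn f g D := by
  intro z hz
  obtain ⟨C, hC⟩ := hD.isAdmissibleWeight.exists_evalBoundOn hD.isOpen isCompact_singleton
    (Set.singleton_subset_iff.2 hz)
  have hbound : ‖f z - g z‖ ^ 2 ≤ 0 :=
    (hC.sq_norm_le _ (sub_mem hf hg) z rfl).trans (mul_nonpos_of_nonneg_of_nonpos hC.nonneg hfg)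
  exact sub_eq_zero.1 (norm_eq_zero.1 (pow_eq_zero_iff two_ne_zero |>.1
    (hbound.antisymm (sq_nonneg _))))

/- Both norms are compared with the same number because
`‖h - κ‖² = ‖h‖² - 2 Re h⁽ⁿ⁾(ζ) + ‖κ‖²`. -/
theorem IsRepresenter.eqOn_of_l2NormSq_le (hD : IsAdmissibleDomain D μ) {κ h : ℂ → ℂ}
    (hκ : IsRepresenter D μ m n ζ κ) (hh : h ∈ vanishingReducedSpace D μ m ζ)
    (hh_le : l2NormSq (weightedArea D μ) h ≤ (iteratedDeriv n h ζ).re)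
    (hκ_le : l2NormSq (weightedArea D μ) κ ≤ (iteratedDeriv n h ζ).re) : Set.EqOn h κ D := by
  refine eqOn_of_l2NormSq_sub_nonpos hD hh.1 hκ.mem.1 ?_
  rw [l2NormSq_sub hh.1.2 hκ.mem.1.2, ← hκ.iteratedDeriv_eq h hh]
  linarith

theorem IsRepresenter.eqOn (hD : IsAdmissibleDomain D μ) {κ κ' : ℂ → ℂ}
    (hκ : IsRepresenter D μ m n ζ κ) (hκ' : IsRepresenter D μ m n ζ κ') : Set.EqOn κ κ' D := by
  have hinner : (l2NormSq (weightedArea D μ) κ : ℂ) = l2NormSq (weightedArea D μ) κ' := by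
    rw [← hκ.iteratedDeriv_self, hκ'.iteratedDeriv_eq κ hκ.mem, ← conj_l2Inner,
      ← hκ.iteratedDeriv_eq κ' hκ'.mem, hκ'.iteratedDeriv_self, Complex.conj_ofReal]
  have hnorm := Complex.ofReal_injective hinner
  refine hκ'.eqOn_of_l2NormSq_le hD hκ.mem ?_ ?_ <;>
    rw [hκ.iteratedDeriv_self, Complex.ofReal_re, hnorm]

theorem differentiableOn_kernelFunction (D : Set ℂ) (μ : ℂ → ℝ) (n : ℕ) (ζ : ℂ) :
    DifferentiableOn ℂ (kernelFunction D μ n ζ) D := by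
  unfold kernelFunction
  split_ifs with hM
  exacts [hM.choose_spec.1.1, differentiableOn_const 0]

theorem hasDerivAt_kernelFunction (hD : IsOpen D) (μ : ℂ → ℝ) (n : ℕ) (ζ : ℂ) {z : ℂ}
    (hz : z ∈ D) : HasDerivAt (kernelFunction D μ n ζ) (reducedKernel D μ n z ζ) z :=
  ((differentiableOn_kernelFunction D μ n ζ).differentiableAt (hD.mem_nhds hz)).hasDerivAt

theorem differentiableOn_reducedKernel (hD : IsOpen D) (μ : ℂ → ℝ) (n : ℕ) (ζ : ℂ) :
    DifferentiableOn ℂ (fun z => reducedKernel D μ n z ζ) D :=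
  (differentiableOn_kernelFunction D μ n ζ).deriv hD

theorem ae_mem_weightedArea (hD : IsOpen D) : ∀ᵐ z ∂(weightedArea D μ), z ∈ D :=
  (withDensity_absolutelyContinuous _ _).ae_le (ae_restrict_mem hD.measurableSet)

theorem l2Inner_weightedArea_congr (hD : IsOpen D) {f f' g g' : ℂ → ℂ} (hf : Set.EqOn f f' D)
    (hg : Set.EqOn g g' D) : l2Inner (weightedArea D μ) f g = l2Inner (weightedArea D μ) f' g' := by
  refine integral_congr_ae ?_
  filter_upwards [ae_mem_weightedArea hD] with z hz
  rw [hf hz, hg hz]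

theorem mem_vanishingReducedSpace_congr (hD : IsOpen D) (hζ : ζ ∈ D) {h h' : ℂ → ℂ}
    (heq : Set.EqOn h h' D) (hh : h ∈ vanishingReducedSpace D μ m ζ) :
    h' ∈ vanishingReducedSpace D μ m ζ := by
  obtain ⟨p, hp⟩ := hh.1.1
  refine (mem_vanishingReducedSpace hD hζ).2
    ⟨⟨⟨p, fun z hz => heq hz ▸ hp z hz⟩, hh.1.2.ae_eq ?_⟩, fun k hk => ?_⟩
  · filter_upwards [ae_mem_weightedArea hD] with z hz using heq hz
  · rw [← eqOn_iteratedDeriv hD heq k hζ, hh.2.2 k hk]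

theorem IsRepresenter.congr (hD : IsOpen D) (hζ : ζ ∈ D) {κ κ' : ℂ → ℂ}
    (hκ : IsRepresenter D μ m n ζ κ) (heq : Set.EqOn κ κ' D) : IsRepresenter D μ m n ζ κ' where
  mem := mem_vanishingReducedSpace_congr hD hζ heq hκ.mem
  iteratedDeriv_eq h hh := by
    rw [hκ.iteratedDeriv_eq h hh, l2Inner_weightedArea_congr hD (Set.eqOn_refl h D) heq]

theorem MemAD.deriv_mem_vanishingReducedSpace (hD : IsOpen D) (hζ : ζ ∈ D) {f : ℂ → ℂ}
    (hf : MemAD D μ (m + 1) ζ f) : deriv f ∈ vanishingReducedSpace D μ m ζ :=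
  (mem_vanishingReducedSpace hD hζ).2
    ⟨⟨⟨f, fun z hz => (hf.1.differentiableAt (hD.mem_nhds hz)).hasDerivAt⟩, hf.2.2⟩,
      fun k hk => by rw [← iteratedDeriv_succ']; exact hf.2.1 (k + 1) (by lia)⟩

theorem exists_memAD_deriv_eqOn (hD : IsOpen D) (hζ : ζ ∈ D) {h : ℂ → ℂ}
    (hh : h ∈ vanishingReducedSpace D μ m ζ) :
    ∃ f, MemAD D μ (m + 1) ζ f ∧ Set.EqOn h (deriv f) D := by
  obtain ⟨f, hfζ, hf⟩ := hh.1.1.with_val_at ζ 0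
  have heq : Set.EqOn h (deriv f) D := fun z hz => (hf z hz).deriv.symm
  have hmem := mem_vanishingReducedSpace_congr hD hζ heq hh
  refine ⟨f, ⟨fun z hz => (hf z hz).differentiableAt.differentiableWithinAt, ?_, hmem.1.2⟩, heq⟩
  rintro (_ | k) hk
  · exact hfζ
  · rw [iteratedDeriv_succ']
    exact hmem.2.2 k (by lia)

theorem isKernelFunction_iff_isRepresenter_deriv (hD : IsOpen D) (hζ : ζ ∈ D) {M : ℂ → ℂ}
    (hM : MemAD D μ (m + 1) ζ M) :
    IsKernelFunction D μ (m + 1) ζ M ↔ IsRepresenter D μ m m ζ (deriv M) := by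
  constructor
  · refine fun hker => ⟨hM.deriv_mem_vanishingReducedSpace hD hζ, fun h hh => ?_⟩
    obtain ⟨f, hf, heq⟩ := exists_memAD_deriv_eqOn hD hζ hh
    rw [eqOn_iteratedDeriv hD heq m hζ, ← iteratedDeriv_succ', hker.2 f hf,
      l2Inner_weightedArea_congr hD heq (Set.eqOn_refl _ D), l2Inner]
  · refine fun hrep => ⟨hM, fun f hf => ?_⟩
    rw [iteratedDeriv_succ', hrep.iteratedDeriv_eq _ (hf.deriv_mem_vanishingReducedSpace hD hζ),
      l2Inner]

theorem IsAdmissibleDomain.isRepresenter_reducedKernel (hD : IsAdmissibleDomain D μ) (hζ : ζ ∈ D)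
    (m : ℕ) : IsRepresenter D μ m m ζ fun z => reducedKernel D μ (m + 1) z ζ := by
  have hexists : ∃ M, IsKernelFunction D μ (m + 1) ζ M := by
    obtain ⟨κ, hκ⟩ := hD.exists_isRepresenter hζ m m
    obtain ⟨M, hM, heq⟩ := exists_memAD_deriv_eqOn hD.isOpen hζ hκ.mem
    exact ⟨M, (isKernelFunction_iff_isRepresenter_deriv hD.isOpen hζ hM).2
      (hκ.congr hD.isOpen hζ heq)⟩
  have hker : IsKernelFunction D μ (m + 1) ζ (kernelFunction D μ (m + 1) ζ) := by
    rw [kernelFunction, dif_pos hexists]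
    exact hexists.choose_spec
  exact (isKernelFunction_iff_isRepresenter_deriv hD.isOpen hζ hker.1).1 hker

/-- The squared norm of `K̃_{D,μ,n}(·, ζ)` in `L²(μ dA)`. -/
noncomputable def reducedKernelNormSq (D : Set ℂ) (μ : ℂ → ℝ) (n : ℕ) (ζ : ℂ) : ℝ :=
  l2NormSq (weightedArea D μ) fun z => reducedKernel D μ n z ζ

theorem IsAdmissibleDomain.reducedKernel_one_self (hD : IsAdmissibleDomain D μ) (hζ : ζ ∈ D) :
    reducedKernel D μ 1 ζ ζ = reducedKernelNormSq D μ 1 ζ :=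
  (hD.isRepresenter_reducedKernel hζ 0).iteratedDeriv_self

end Representers

section MixedDerivatives

variable {D : Set ℂ} {μ : ℂ → ℝ} {z w : ℂ}

theorem kernelMixedDeriv_zero_zero (D : Set ℂ) (μ : ℂ → ℝ) (z w : ℂ) :
    kernelMixedDeriv D μ 0 0 z w = reducedKernel D μ 1 z w := by
  simp only [kernelMixedDeriv, iteratedDeriv_zero, Complex.conj_conj]

theorem iteratedDeriv_kernelMixedDeriv_zero (D : Set ℂ) (μ : ℂ → ℝ) (j k : ℕ) (w : ℂ) :
    iteratedDeriv j (fun z => kernelMixedDeriv D μ 0 k z w) =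
      fun z => kernelMixedDeriv D μ j k z w := by
  simp only [kernelMixedDeriv, iteratedDeriv_zero]

theorem mem_vanishingReducedSpace_zero (hD : IsOpen D) (hw : w ∈ D) {h : ℂ → ℂ} :
    h ∈ vanishingReducedSpace D μ 0 w ↔ h ∈ reducedSpace D μ := by
  simp [mem_vanishingReducedSpace hD hw]

theorem IsAdmissibleDomain.conj_reducedKernel_one (hD : IsAdmissibleDomain D μ) (hz : z ∈ D)
    (hw : w ∈ D) : conj (reducedKernel D μ 1 z w) = reducedKernel D μ 1 w z := by
  have hrep {ζ : ℂ} (hζ : ζ ∈ D) := hD.isRepresenter_reducedKernel hζ 0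
  have hmem {ζ η : ℂ} (hζ : ζ ∈ D) (hη : η ∈ D) :=
    (mem_vanishingReducedSpace_zero hD.isOpen hη).2 (hrep hζ).mem.1
  have hzw := (hrep hz).iteratedDeriv_eq _ (hmem hw hz)
  have hwz := (hrep hw).iteratedDeriv_eq _ (hmem hz hw)
  rw [iteratedDeriv_zero] at hzw hwz
  rw [hzw, hwz, conj_l2Inner]

theorem IsAdmissibleDomain.isRepresenter_kernelMixedDeriv (hD : IsAdmissibleDomain D μ)
    (hw : w ∈ D) (k : ℕ) : IsRepresenter D μ 0 k w fun z => kernelMixedDeriv D μ 0 k z w := by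
  obtain ⟨e, he⟩ := hD.exists_isRepresenter hw 0 k
  refine he.congr hD.isOpen hw fun z hz => ?_
  have hK := hD.isRepresenter_reducedKernel hz 0
  have hez : e z = l2Inner (weightedArea D μ) e fun z' => reducedKernel D μ 1 z' z := by
    simpa only [iteratedDeriv_zero] using
      hK.iteratedDeriv_eq e ((mem_vanishingReducedSpace_zero hD.isOpen hz).2 he.mem.1)
  have hconj : Set.EqOn (fun ζ => conj (reducedKernel D μ 1 z ζ))
      (fun ζ => reducedKernel D μ 1 ζ z) D := fun ζ hζ => hD.conj_reducedKernel_one hz hζ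
  rw [kernelMixedDeriv, iteratedDeriv_zero, eqOn_iteratedDeriv hD.isOpen hconj k hw,
    he.iteratedDeriv_eq _ ((mem_vanishingReducedSpace_zero hD.isOpen hw).2 hK.mem.1),
    conj_l2Inner, hez]

theorem IsAdmissibleDomain.kernelMixedDeriv_eq_l2Inner (hD : IsAdmissibleDomain D μ) (j k : ℕ)
    (hz : z ∈ D) (hw : w ∈ D) :
    kernelMixedDeriv D μ j k z w = l2Inner (weightedArea D μ)
      (fun ζ => kernelMixedDeriv D μ 0 k ζ w) fun ζ => kernelMixedDeriv D μ 0 j ζ z := by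
  rw [← (hD.isRepresenter_kernelMixedDeriv hz j).iteratedDeriv_eq _
    ((mem_vanishingReducedSpace_zero hD.isOpen hz).2
      (hD.isRepresenter_kernelMixedDeriv hw k).mem.1), iteratedDeriv_kernelMixedDeriv_zero]

theorem IsAdmissibleDomain.conj_kernelMixedDeriv (hD : IsAdmissibleDomain D μ) (j k : ℕ)
    (hz : z ∈ D) (hw : w ∈ D) :
    conj (kernelMixedDeriv D μ j k z w) = kernelMixedDeriv D μ k j w z := by
  rw [hD.kernelMixedDeriv_eq_l2Inner j k hz hw, hD.kernelMixedDeriv_eq_l2Inner k j hw hz,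
    conj_l2Inner]

theorem IsAdmissibleDomain.differentiableOn_kernelMixedDeriv (hD : IsAdmissibleDomain D μ)
    (j k : ℕ) (hw : w ∈ D) : DifferentiableOn ℂ (fun z => kernelMixedDeriv D μ j k z w) D := by
  rw [← iteratedDeriv_kernelMixedDeriv_zero]
  exact differentiableOn_iteratedDeriv hD.isOpen
    ((hD.isRepresenter_kernelMixedDeriv hw k).mem.1.1.differentiableOn hD.isOpen) j

theorem deriv_kernelMixedDeriv (D : Set ℂ) (μ : ℂ → ℝ) (j k : ℕ) (z w : ℂ) :
    deriv (fun z => kernelMixedDeriv D μ j k z w) z = kernelMixedDeriv D μ (j + 1) k z w := by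
  rw [← iteratedDeriv_kernelMixedDeriv_zero, ← iteratedDeriv_succ,
    iteratedDeriv_kernelMixedDeriv_zero]

theorem IsAdmissibleDomain.hasDerivAt_kernelMixedDeriv (hD : IsAdmissibleDomain D μ) (j k : ℕ)
    (hz : z ∈ D) (hw : w ∈ D) :
    HasDerivAt (fun z => kernelMixedDeriv D μ j k z w) (kernelMixedDeriv D μ (j + 1) k z w) z := by
  rw [← deriv_kernelMixedDeriv]
  exact ((hD.differentiableOn_kernelMixedDeriv j k hw).differentiableAt
    (hD.isOpen.mem_nhds hz)).hasDerivAt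

end MixedDerivatives

section BorderedDeterminant

open Matrix

theorem det_updateRow_eq_sum_mul_adjugate {n R : Type*} [Fintype n] [DecidableEq n] [CommRing R]
    (A : Matrix n n R) (i : n) (v : n → R) :
    (A.updateRow i v).det = ∑ k, v k * A.adjugate k i := by
  rw [← cramer_transpose_apply, cramer_eq_adjugate_mulVec, ← adjugate_transpose]
  simp only [mulVec, dotProduct, transpose_apply, mul_comm]

theorem adjugate_last_last {R : Type*} [CommRing R] {n : ℕ}
    (A : Matrix (Fin (n + 1)) (Fin (n + 1)) R) :
    A.adjugate (Fin.last n) (Fin.last n) = (A.submatrix Fin.castSucc Fin.castSucc).det := by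
  rw [adjugate_fin_succ_eq_det_submatrix, Fin.succAbove_last, Even.neg_one_pow ⟨_, rfl⟩, one_mul]

variable {D : Set ℂ} {μ : ℂ → ℝ} {m : ℕ} {z w : ℂ}

/-- The Gram matrix of the functionals `h ↦ h⁽ᵏ⁾(w)`, `k ≤ m`, on the reduced Bergman space. Its
determinant is `J_m(w)`. -/
noncomputable def kernelGramMatrix (D : Set ℂ) (μ : ℂ → ℝ) (m : ℕ) (w : ℂ) :
    Matrix (Fin (m + 1)) (Fin (m + 1)) ℂ :=
  Matrix.of fun j k => kernelMixedDeriv D μ j k w w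

theorem det_submatrix_kernelGramMatrix (D : Set ℂ) (μ : ℂ → ℝ) (m : ℕ) (w : ℂ) :
    ((kernelGramMatrix D μ (m + 1) w).submatrix Fin.castSucc Fin.castSucc).det =
      kernelGramDet D μ m w :=
  rfl

theorem IsAdmissibleDomain.isRepresenter_sum_kernelMixedDeriv (hD : IsAdmissibleDomain D μ)
    (hw : w ∈ D) {c : Fin (m + 1) → ℂ} (hc : c (Fin.last m) = 1)
    (hortho : ∀ j ≠ Fin.last m, (kernelGramMatrix D μ m w *ᵥ c) j = 0) :
    IsRepresenter D μ m m w (∑ k, c k • fun z => kernelMixedDeriv D μ 0 k z w) := by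
  let e (k : Fin (m + 1)) : ℂ → ℂ := fun z => kernelMixedDeriv D μ 0 k z w
  have hrep (k : Fin (m + 1)) : IsRepresenter D μ 0 k w (e k) :=
    hD.isRepresenter_kernelMixedDeriv hw k
  have hsmooth (k : Fin (m + 1)) (j : ℕ) : ContDiffAt ℂ j (e k) w := (hrep k).mem.2.1.contDiffAt
  refine ⟨(mem_vanishingReducedSpace hD.isOpen hw).2
    ⟨sum_mem fun k _ => Submodule.smul_mem _ _ (hrep k).mem.1, fun j hj => ?_⟩, fun h hh => ?_⟩
  · have hderiv (k : Fin (m + 1)) :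
        iteratedDeriv j (c k • e k) w = kernelMixedDeriv D μ j k w w * c k := by
      rw [iteratedDeriv_const_smul (hsmooth k j), iteratedDeriv_kernelMixedDeriv_zero, smul_eq_mul,
        mul_comm]
    have hsum : iteratedDeriv j (∑ k, c k • e k) w = ∑ k, iteratedDeriv j (c k • e k) w :=
      iteratedDeriv_sum fun k _ => (hsmooth k j).const_smul (c k)
    exact hsum.trans <| (Finset.sum_congr rfl fun k _ => hderiv k).trans
      (hortho ⟨j, by lia⟩ (Fin.ne_of_lt hj))
  · have hinner (k : Fin (m + 1)) : l2Inner (weightedArea D μ) h (e k) = iteratedDeriv k h w :=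
      ((hrep k).iteratedDeriv_eq h ((mem_vanishingReducedSpace_zero hD.isOpen hw).2 hh.1)).symm
    have hsum := l2Inner_sum_smul_right Finset.univ c hh.1.2 fun k _ => (hrep k).mem.1.2
    rw [Fin.sum_univ_castSucc (fun k => conj (c k) * _)] at hsum
    simpa [hinner, hh.2.2, hc] using hsum.symm

theorem IsAdmissibleDomain.reducedKernel_eq_det_div (hD : IsAdmissibleDomain D μ) (m : ℕ)
    (hz : z ∈ D) (hw : w ∈ D) (hJ : kernelGramDet D μ m w ≠ 0) :
    reducedKernel D μ (m + 2) z w =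
      ((kernelGramMatrix D μ (m + 1) w).updateRow (Fin.last (m + 1))
        fun k => kernelMixedDeriv D μ 0 k z w).det / kernelGramDet D μ m w := by
  let A := kernelGramMatrix D μ (m + 1) w
  let c : Fin (m + 2) → ℂ := fun k => A.adjugate k (Fin.last _) / kernelGramDet D μ m w
  have hc : c (Fin.last _) = 1 := by
    rw [div_eq_one_iff_eq hJ, adjugate_last_last, det_submatrix_kernelGramMatrix]
  have hortho : ∀ j ≠ Fin.last _, (A *ᵥ c) j = 0 := fun j hj => by
    have hadj := congrFun₂ (mul_adjugate A) j (Fin.last _)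
    rw [mul_apply, Matrix.smul_apply, one_apply_ne hj, smul_zero] at hadj
    simp only [mulVec, dotProduct, c, mul_div_assoc', ← Finset.sum_div, hadj, zero_div]
  have hrep := hD.isRepresenter_sum_kernelMixedDeriv hw hc hortho
  rw [det_updateRow_eq_sum_mul_adjugate, Finset.sum_div]
  refine ((hD.isRepresenter_reducedKernel hw (m + 1)).eqOn hD hrep hz).trans ?_
  simp only [Finset.sum_apply, Pi.smul_apply, smul_eq_mul, c, mul_comm, mul_div_assoc', A]

end BorderedDeterminant

section KernelConvergence

variable {D : ℕ → Set ℂ} {μ : ℕ → ℂ → ℝ} {Ω : Set ℂ} {ν : ℂ → ℝ}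

/-- Locally uniform convergence of the first-order reduced kernels of the domains `D i`, which
eventually contain each compact subset of `Ω`. It is phrased as joint convergence along
`atTop ×ˢ 𝓝 (z, w)`, from which the derivatives in one variable converge with the other variable as
a parameter. -/
structure KernelConvergence (D : ℕ → Set ℂ) (μ : ℕ → ℂ → ℝ) (Ω : Set ℂ) (ν : ℂ → ℝ) : Prop where
  domain : ∀ i, IsAdmissibleDomain (D i) (μ i)
  domain_lim : IsAdmissibleDomain Ω ν
  eventually_subset : ∀ L ⊆ Ω, IsCompact L → ∀ᶠ i in atTop, L ⊆ D i
  tendsto : ∀ z ∈ Ω, ∀ w ∈ Ω,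
    Tendsto (fun x : ℕ × (ℂ × ℂ) => reducedKernel (D x.1) (μ x.1) 1 x.2.1 x.2.2)
      (atTop ×ˢ 𝓝 (z, w)) (𝓝 (reducedKernel Ω ν 1 z w))

theorem dist_le_mul_dist_of_norm_le {f : ℂ → ℂ} {c : ℂ} {r C : ℝ}
    (hf : DifferentiableOn ℂ f (Metric.ball c r)) (hC : ∀ z ∈ Metric.ball c r, ‖f z‖ ≤ C)
    {z : ℂ} (hz : z ∈ Metric.ball c r) : dist (f z) (f c) ≤ 2 * C / r * dist z c := by
  have hc : c ∈ Metric.ball c r := Metric.mem_ball_self (Metric.pos_of_mem_ball hz)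
  refine Complex.dist_le_div_mul_dist_of_mapsTo_ball hf (fun x hx => ?_) hz
  rw [Metric.mem_closedBall, two_mul]
  exact (dist_le_norm_add_norm _ _).trans (add_le_add (hC x hx) (hC c hc))

theorem IsAdmissibleDomain.dist_reducedKernel_le {D : Set ℂ} {μ : ℂ → ℝ}
    (hD : IsAdmissibleDomain D μ) {z w : ℂ} {r C : ℝ}
    (hz : Metric.ball z r ⊆ D) (hw : Metric.ball w r ⊆ D)
    (hC : ∀ z' ∈ Metric.ball z r, ∀ w' ∈ Metric.ball w r, ‖reducedKernel D μ 1 z' w'‖ ≤ C)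
    {p : ℂ × ℂ} (hp : p ∈ Metric.ball z r ×ˢ Metric.ball w r) :
    dist (reducedKernel D μ 1 p.1 p.2) (reducedKernel D μ 1 z w) ≤
      2 * (2 * C / r) * dist p (z, w) := by
  have hr : 0 < r := Metric.pos_of_mem_ball hp.1
  have hz₀ := Metric.mem_ball_self (x := z) hr
  have hw₀ := Metric.mem_ball_self (x := w) hr
  have hC₀ : 0 ≤ C := (norm_nonneg _).trans (hC z hz₀ w hw₀)
  have hdiff (ζ : ℂ) := differentiableOn_reducedKernel hD.isOpen μ 1 ζ
  have hleft : dist (reducedKernel D μ 1 p.1 p.2) (reducedKernel D μ 1 z p.2) ≤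
      2 * C / r * dist p.1 z :=
    dist_le_mul_dist_of_norm_le ((hdiff p.2).mono hz) (fun x hx => hC x hx _ hp.2) hp.1
  have hright : dist (reducedKernel D μ 1 z p.2) (reducedKernel D μ 1 z w) ≤
      2 * C / r * dist p.2 w := by
    rw [← hD.conj_reducedKernel_one (hw hp.2) (hz hz₀),
      ← hD.conj_reducedKernel_one (hw hw₀) (hz hz₀), Complex.dist_conj_conj]
    refine dist_le_mul_dist_of_norm_le ((hdiff z).mono hw) (fun x hx => ?_) hp.2
    rw [← hD.conj_reducedKernel_one (hz hz₀) (hw hx), RCLike.norm_conj]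
    exact hC z hz₀ x hx
  calc dist (reducedKernel D μ 1 p.1 p.2) (reducedKernel D μ 1 z w)
      ≤ 2 * C / r * dist p.1 z + 2 * C / r * dist p.2 w :=
        (dist_triangle _ _ _).trans (add_le_add hleft hright)
    _ ≤ 2 * C / r * dist p (z, w) + 2 * C / r * dist p (z, w) := by
        gcongr
        exacts [le_max_left _ _, le_max_right _ _]
    _ = 2 * (2 * C / r) * dist p (z, w) := by ring

theorem KernelConvergence.of_bound (hD : ∀ i, IsAdmissibleDomain (D i) (μ i))
    (hΩ : IsAdmissibleDomain Ω ν)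
    (hbound : ∀ L ⊆ Ω, IsCompact L → ∃ C : ℝ, ∀ᶠ i in atTop, L ⊆ D i ∧
      ∀ z ∈ L, ∀ w ∈ L, ‖reducedKernel (D i) (μ i) 1 z w‖ ≤ C)
    (hlim : ∀ z ∈ Ω, ∀ w ∈ Ω, Tendsto (fun i => reducedKernel (D i) (μ i) 1 z w) atTop
      (𝓝 (reducedKernel Ω ν 1 z w))) : KernelConvergence D μ Ω ν where
  domain := hD
  domain_lim := hΩ
  eventually_subset L hLΩ hL := by
    obtain ⟨C, hC⟩ := hbound L hLΩ hL
    exact hC.mono fun i hi => hi.1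
  tendsto z hz w hw := by
    have hcpt : IsCompact {z, w} := (Set.toFinite _).isCompact
    obtain ⟨r, hr, hsub⟩ := hcpt.exists_cthickening_subset_open hΩ.isOpen
      (Set.pair_subset hz hw)
    obtain ⟨C, hC⟩ := hbound _ hsub hcpt.cthickening
    have hball {ζ : ℂ} (hζ : ζ ∈ ({z, w} : Set ℂ)) :
        Metric.ball ζ r ⊆ Metric.cthickening r {z, w} :=
      Metric.ball_subset_closedBall.trans (Metric.closedBall_subset_cthickening hζ r)
    have hzr := hball (Set.mem_insert z {w})
    have hwr := hball (Set.mem_insert_of_mem z (Set.mem_singleton w))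
    refine tendsto_prod_nhds_of_dist_le_mul_dist
      (F := fun i (p : ℂ × ℂ) => reducedKernel (D i) (μ i) 1 p.1 p.2) (2 * (2 * C / r))
      (hlim z hz w hw) ?_
    filter_upwards [prod_mem_prod hC (prod_mem_nhds (Metric.ball_mem_nhds z hr)
      (Metric.ball_mem_nhds w hr))] with x ⟨⟨hsubx, hCx⟩, hx⟩
    exact (hD x.1).dist_reducedKernel_le (hzr.trans hsubx) (hwr.trans hsubx)
      (fun z' hz' w' hw' => hCx z' (hzr hz') w' (hwr hw')) hx

theorem IsAdmissibleDomain.norm_reducedKernel_le {D : Set ℂ} {μ : ℂ → ℝ}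
    (hD : IsAdmissibleDomain D μ) {L : Set ℂ} (hL : L ⊆ D) {C : ℝ} (hC : EvalBoundOn D μ L C)
    {z w : ℂ} (hz : z ∈ L) (hw : w ∈ L) : ‖reducedKernel D μ 1 z w‖ ≤ C := by
  let N : ℝ := reducedKernelNormSq D μ 1 w
  have hbound : ∀ ζ ∈ L, ‖reducedKernel D μ 1 ζ w‖ ^ 2 ≤ C * N :=
    hC.sq_norm_le _ (hD.isRepresenter_reducedKernel (hL hw) 0).mem.1
  have hN : N ≤ C := by
    have hsq := hbound w hw
    rw [hD.reducedKernel_one_self (hL hw), Complex.norm_real, Real.norm_eq_abs, sq_abs] at hsq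
    nlinarith [hC.nonneg]
  refine (pow_le_pow_iff_left₀ (norm_nonneg _) hC.nonneg two_ne_zero).1 ((hbound z hz).trans ?_)
  rw [sq]
  exact mul_le_mul_of_nonneg_left hN hC.nonneg

theorem IsAdmissibleDomain.kernelConvergence_const {D : Set ℂ} {μ : ℂ → ℝ}
    (hD : IsAdmissibleDomain D μ) : KernelConvergence (fun _ => D) (fun _ => μ) D μ := by
  refine .of_bound (fun _ => hD) hD (fun L hLD hL => ?_) fun _ _ _ _ => tendsto_const_nhds
  obtain ⟨C, hC⟩ := hD.isAdmissibleWeight.exists_evalBoundOn hD.isOpen hL hLD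
  exact ⟨C, .of_forall fun _ => ⟨hLD, fun z hz w hw => hD.norm_reducedKernel_le hLD hC hz hw⟩⟩

namespace KernelConvergence

theorem eventually_mem (H : KernelConvergence D μ Ω ν) {z : ℂ} (hz : z ∈ Ω) :
    ∀ᶠ x : ℕ × ℂ in atTop ×ˢ 𝓝 z, x.2 ∈ D x.1 := by
  obtain ⟨L, hLz, hLΩ, hL⟩ := local_compact_nhds (H.domain_lim.isOpen.mem_nhds hz)
  filter_upwards [prod_mem_prod (H.eventually_subset L hLΩ hL) hLz] with x hx
  exact hx.1 hx.2

theorem eventually_mem_prod (H : KernelConvergence D μ Ω ν) {p : ℂ × ℂ} (hp : p ∈ Ω ×ˢ Ω) :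
    ∀ᶠ x : ℕ × (ℂ × ℂ) in atTop ×ˢ 𝓝 p, x.2 ∈ D x.1 ×ˢ D x.1 :=
  ((tendsto_id.prodMap continuous_fst.continuousAt).eventually (H.eventually_mem hp.1)).and
    ((tendsto_id.prodMap continuous_snd.continuousAt).eventually (H.eventually_mem hp.2))

theorem tendsto_kernelMixedDeriv_swap (H : KernelConvergence D μ Ω ν) {j k : ℕ} {z w : ℂ}
    (hz : z ∈ Ω) (hw : w ∈ Ω)
    (h : Tendsto (fun x : ℕ × (ℂ × ℂ) => kernelMixedDeriv (D x.1) (μ x.1) j k x.2.1 x.2.2)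
      (atTop ×ˢ 𝓝 (w, z)) (𝓝 (kernelMixedDeriv Ω ν j k w z))) :
    Tendsto (fun x : ℕ × (ℂ × ℂ) => kernelMixedDeriv (D x.1) (μ x.1) k j x.2.1 x.2.2)
      (atTop ×ˢ 𝓝 (z, w)) (𝓝 (kernelMixedDeriv Ω ν k j z w)) := by
  rw [← H.domain_lim.conj_kernelMixedDeriv j k hw hz]
  have hswap : Tendsto (Prod.map id Prod.swap) (atTop ×ˢ 𝓝 (z, w))
      ((atTop : Filter ℕ) ×ˢ 𝓝 (w, z)) := tendsto_id.prodMap continuous_swap.continuousAt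
  refine ((Complex.continuous_conj.tendsto _).comp (h.comp hswap)).congr' ?_
  filter_upwards [H.eventually_mem_prod (p := (z, w)) ⟨hz, hw⟩] with x hx
  exact (H.domain x.1).conj_kernelMixedDeriv j k hx.2 hx.1

theorem tendsto_kernelMixedDeriv_succ (H : KernelConvergence D μ Ω ν) {j k : ℕ} {w : ℂ}
    (hw : w ∈ Ω)
    (h : ∀ z ∈ Ω, Tendsto (fun x : ℕ × (ℂ × ℂ) =>
      kernelMixedDeriv (D x.1) (μ x.1) j k x.2.1 x.2.2)
      (atTop ×ˢ 𝓝 (z, w)) (𝓝 (kernelMixedDeriv Ω ν j k z w))) {z : ℂ} (hz : z ∈ Ω) :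
    Tendsto (fun x : ℕ × (ℂ × ℂ) => kernelMixedDeriv (D x.1) (μ x.1) (j + 1) k x.2.1 x.2.2)
      (atTop ×ˢ 𝓝 (z, w)) (𝓝 (kernelMixedDeriv Ω ν (j + 1) k z w)) := by
  obtain ⟨r, hr, hball⟩ := Metric.nhds_basis_closedBall.mem_iff.1 (H.domain_lim.isOpen.mem_nhds hz)
  have hballΩ : Metric.ball z r ⊆ Ω := Metric.ball_subset_closedBall.trans hball
  simp only [← deriv_kernelMixedDeriv _ _ j k]
  refine tendsto_deriv_prod_of_forall_tendsto_prod Metric.isOpen_ball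
    (F := fun i z w => kernelMixedDeriv (D i) (μ i) j k z w)
    ((H.domain_lim.differentiableOn_kernelMixedDeriv j k hw).mono hballΩ) ?_
    (fun ζ hζ => h ζ (hballΩ hζ)) (Metric.mem_ball_self hr)
  filter_upwards [H.eventually_mem hw, tendsto_fst.eventually
    (H.eventually_subset _ hball (isCompact_closedBall z r))] with y hy hsub
  exact ((H.domain y.1).differentiableOn_kernelMixedDeriv j k hy).mono
    (Metric.ball_subset_closedBall.trans hsub)

theorem tendsto_kernelMixedDeriv (H : KernelConvergence D μ Ω ν) (j k : ℕ) {z w : ℂ}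
    (hz : z ∈ Ω) (hw : w ∈ Ω) :
    Tendsto (fun x : ℕ × (ℂ × ℂ) => kernelMixedDeriv (D x.1) (μ x.1) j k x.2.1 x.2.2)
      (atTop ×ˢ 𝓝 (z, w)) (𝓝 (kernelMixedDeriv Ω ν j k z w)) := by
  induction j generalizing z w with
  | zero =>
    refine H.tendsto_kernelMixedDeriv_swap hz hw ?_
    induction k generalizing z w with
    | zero => simpa only [kernelMixedDeriv_zero_zero] using H.tendsto w hw z hz
    | succ k ih => exact H.tendsto_kernelMixedDeriv_succ hz (fun ζ hζ => ih hz hζ) hw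
  | succ j ih => exact H.tendsto_kernelMixedDeriv_succ hw (fun ζ hζ => ih hζ hw) hz

end KernelConvergence

end KernelConvergence

section SmoothConvergence

theorem IsAdmissibleDomain.continuousAt_kernelMixedDeriv {D : Set ℂ} {μ : ℂ → ℝ}
    (hD : IsAdmissibleDomain D μ) (j k : ℕ) {p : ℂ × ℂ} (hp : p ∈ D ×ˢ D) :
    ContinuousAt (fun p : ℂ × ℂ => kernelMixedDeriv D μ j k p.1 p.2) p := by
  have h : Tendsto ((fun p : ℂ × ℂ => kernelMixedDeriv D μ j k p.1 p.2) ∘ Prod.snd)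
      ((atTop : Filter ℕ) ×ˢ 𝓝 p) (𝓝 (kernelMixedDeriv D μ j k p.1 p.2)) :=
    hD.kernelConvergence_const.tendsto_kernelMixedDeriv j k hp.1 hp.2
  rwa [← tendsto_map'_iff, map_snd_prod] at h

/-- The real-linear map `a dz + b dw̄` on `ℂ × ℂ`, the shape of the differentials of functions that
are holomorphic in the first and antiholomorphic in the second variable. -/
noncomputable def sesquiholomorphicDifferential (v : ℂ × ℂ) : ℂ × ℂ →L[ℝ] ℂ :=
  v.1 • ContinuousLinearMap.fst ℝ ℂ ℂ +
    v.2 • (Complex.conjCLE : ℂ →L[ℝ] ℂ).comp (ContinuousLinearMap.snd ℝ ℂ ℂ)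

theorem contDiff_sesquiholomorphicDifferential {n : WithTop ℕ∞} :
    ContDiff ℝ n sesquiholomorphicDifferential := by
  unfold sesquiholomorphicDifferential
  fun_prop

theorem IsAdmissibleDomain.hasFDerivAt_kernelMixedDeriv {D : Set ℂ} {μ : ℂ → ℝ}
    (hD : IsAdmissibleDomain D μ) (j k : ℕ) {p : ℂ × ℂ} (hp : p ∈ D ×ˢ D) :
    HasFDerivAt (fun p : ℂ × ℂ => kernelMixedDeriv D μ j k p.1 p.2)
      (sesquiholomorphicDifferential
        (kernelMixedDeriv D μ (j + 1) k p.1 p.2, kernelMixedDeriv D μ j (k + 1) p.1 p.2)) p := by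
  let dz (z w : ℂ) : ℂ →L[ℝ] ℂ :=
    kernelMixedDeriv D μ (j + 1) k z w • ContinuousLinearMap.id ℝ ℂ
  let dw (z w : ℂ) : ℂ →L[ℝ] ℂ :=
    kernelMixedDeriv D μ j (k + 1) z w • (Complex.conjCLE : ℂ →L[ℝ] ℂ)
  have hnhds : D ×ˢ D ∈ 𝓝 p := (hD.isOpen.prod hD.isOpen).mem_nhds hp
  have hdz : ∀ᶠ v in 𝓝 p, HasFDerivAt (fun z => kernelMixedDeriv D μ j k z v.2)
      (dz v.1 v.2) v.1 := by
    filter_upwards [hnhds] with v hv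
    exact ((hD.hasDerivAt_kernelMixedDeriv j k hv.1 hv.2).hasFDerivAt.restrictScalars
      ℝ).congr_fderiv (by ext; simp [dz, mul_comm])
  have hdw : ∀ᶠ v in 𝓝 p, HasFDerivAt (fun w => kernelMixedDeriv D μ j k v.1 w)
      (dw v.1 v.2) v.2 := by
    filter_upwards [hnhds] with v hv
    have hconj := (Complex.conjCLE : ℂ →L[ℝ] ℂ).hasFDerivAt.comp v.2
      ((hD.hasDerivAt_kernelMixedDeriv k j hv.2 hv.1).hasFDerivAt.restrictScalars ℝ)
    refine (hconj.congr_fderiv ?_).congr_of_eventuallyEq ?_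
    · ext; simp [dw, ← hD.conj_kernelMixedDeriv (k + 1) j hv.2 hv.1, mul_comm]
    · filter_upwards [hD.isOpen.mem_nhds hv.2] with w hw
        using (hD.conj_kernelMixedDeriv k j hw hv.1).symm
  have hdz_cont : ContinuousAt (fun v : ℂ × ℂ => dz v.1 v.2) p :=
    (hD.continuousAt_kernelMixedDeriv (j + 1) k hp).smul continuousAt_const
  have hdw_cont : ContinuousAt (fun v : ℂ × ℂ => dw v.1 v.2) p :=
    (hD.continuousAt_kernelMixedDeriv j (k + 1) hp).smul continuousAt_const
  refine (hasStrictFDerivAt_uncurry_coprod (f := fun z w => kernelMixedDeriv D μ j k z w)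
    (f₁ := dz) (f₂ := dw) hdz hdw hdz_cont hdw_cont).hasFDerivAt.congr_fderiv ?_
  ext <;> simp [sesquiholomorphicDifferential, dz, dw, Function.HasUncurry.uncurry]

namespace KernelConvergence

variable {D : ℕ → Set ℂ} {μ : ℕ → ℂ → ℝ} {Ω : Set ℂ} {ν : ℂ → ℝ}

theorem tendstoContDiffAt_natCast_kernelMixedDeriv (H : KernelConvergence D μ Ω ν) (m j k : ℕ)
    {p : ℂ × ℂ} (hp : p ∈ Ω ×ˢ Ω) :
    TendstoContDiffAt ℝ atTop m (fun i q => kernelMixedDeriv (D i) (μ i) j k q.1 q.2)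
      (fun q => kernelMixedDeriv Ω ν j k q.1 q.2) p := by
  have hΩ : ∀ᶠ q in 𝓝 p, q ∈ Ω ×ˢ Ω := (H.domain_lim.isOpen.prod H.domain_lim.isOpen).mem_nhds hp
  have hlim (j k : ℕ) := H.tendsto_kernelMixedDeriv j k hp.1 hp.2
  induction m generalizing j k with
  | zero =>
    refine .of_continuousAt (hlim j k) ?_ ?_
    · filter_upwards [H.eventually_mem_prod hp] with x hx
        using (H.domain x.1).continuousAt_kernelMixedDeriv j k hx
    · filter_upwards [hΩ] with q hq using H.domain_lim.continuousAt_kernelMixedDeriv j k hq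
  | succ m ih =>
    refine .succ (hlim j k) ?_ ?_ (.comp
      (.of_eventually_contDiffAt (.of_forall fun _ =>
        contDiff_sesquiholomorphicDifferential.contDiffAt))
      ((ih (j + 1) k).prodMk (ih j (k + 1))))
    · filter_upwards [H.eventually_mem_prod hp] with x hx
        using (H.domain x.1).hasFDerivAt_kernelMixedDeriv j k hx
    · filter_upwards [hΩ] with q hq using H.domain_lim.hasFDerivAt_kernelMixedDeriv j k hq

end KernelConvergence

theorem IsAdmissibleDomain.contDiffAt_kernelMixedDeriv {D : Set ℂ} {μ : ℂ → ℝ}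
    (hD : IsAdmissibleDomain D μ) (j k : ℕ) {p : ℂ × ℂ} (hp : p ∈ D ×ˢ D) :
    ContDiffAt ℝ ∞ (fun p : ℂ × ℂ => kernelMixedDeriv D μ j k p.1 p.2) p :=
  contDiffAt_infty.2 fun m =>
    (hD.kernelConvergence_const.tendstoContDiffAt_natCast_kernelMixedDeriv m j k hp).contDiffAt

section BorderedDetQuotient

variable {n : ℕ}

/-- The quotient of determinants expressing the kernel of order `n + 2` at `(z, w)` through the
mixed derivatives `X j k` of the first-order kernel at `(w, w)` and `v k` at `(z, w)`. -/
noncomputable def borderedDetQuotient (x : (Fin (n + 2) → Fin (n + 2) → ℂ) × (Fin (n + 2) → ℂ)) :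
    ℂ :=
  ((Matrix.of x.1).updateRow (Fin.last (n + 1)) x.2).det /
    ((Matrix.of x.1).submatrix Fin.castSucc Fin.castSucc).det

theorem contDiff_matrix_det {𝕜 E R κ : Type*} [NontriviallyNormedField 𝕜] [NormedAddCommGroup E]
    [NormedSpace 𝕜 E] [NormedCommRing R] [NormedAlgebra 𝕜 R] [Fintype κ] [DecidableEq κ]
    {A : E → Matrix κ κ R} {m : WithTop ℕ∞} (hA : ∀ j k, ContDiff 𝕜 m fun x => A x j k) :
    ContDiff 𝕜 m fun x => (A x).det := by
  simp only [Matrix.det_apply]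
  fun_prop

theorem contDiffAt_borderedDetQuotient
    {x : (Fin (n + 2) → Fin (n + 2) → ℂ) × (Fin (n + 2) → ℂ)}
    (hx : ((Matrix.of x.1).submatrix Fin.castSucc Fin.castSucc).det ≠ 0) :
    ContDiffAt ℝ ∞ borderedDetQuotient x := by
  have hnum : ContDiff ℝ ∞ fun x : (Fin (n + 2) → Fin (n + 2) → ℂ) × (Fin (n + 2) → ℂ) =>
      ((Matrix.of x.1).updateRow (Fin.last (n + 1)) x.2).det := by
    refine contDiff_matrix_det fun j k => ?_
    simp only [Matrix.updateRow_apply, Matrix.of_apply]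
    split_ifs <;> fun_prop
  have hden : ContDiff ℝ ∞ fun x : (Fin (n + 2) → Fin (n + 2) → ℂ) × (Fin (n + 2) → ℂ) =>
      ((Matrix.of x.1).submatrix Fin.castSucc Fin.castSucc).det := by
    refine contDiff_matrix_det fun j k => ?_
    simp only [Matrix.submatrix_apply, Matrix.of_apply]
    fun_prop
  exact hnum.contDiffAt.mul (hden.contDiffAt.inv hx)

end BorderedDetQuotient

theorem KernelConvergence.tendsto_kernelMixedDeriv_diag {D : ℕ → Set ℂ} {μ : ℕ → ℂ → ℝ} {Ω : Set ℂ}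
    {ν : ℂ → ℝ} (H : KernelConvergence D μ Ω ν) (j k : ℕ) {w : ℂ} (hw : w ∈ Ω) :
    Tendsto (fun x : ℕ × ℂ => kernelMixedDeriv (D x.1) (μ x.1) j k x.2 x.2) (atTop ×ˢ 𝓝 w)
      (𝓝 (kernelMixedDeriv Ω ν j k w w)) := by
  have hdiag : Tendsto (fun x : ℕ × ℂ => (x.1, x.2, x.2)) (atTop ×ˢ 𝓝 w)
      (atTop ×ˢ 𝓝 (w, w)) :=
    tendsto_fst.prodMk (tendsto_snd.prodMk_nhds tendsto_snd)
  simpa only [Function.comp_def] using (H.tendsto_kernelMixedDeriv j k hw hw).comp hdiag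

theorem KernelConvergence.tendsto_kernelGramDet {D : ℕ → Set ℂ} {μ : ℕ → ℂ → ℝ} {Ω : Set ℂ}
    {ν : ℂ → ℝ} (H : KernelConvergence D μ Ω ν) (m : ℕ) {w : ℂ} (hw : w ∈ Ω) :
    Tendsto (fun x : ℕ × ℂ => kernelGramDet (D x.1) (μ x.1) m x.2) (atTop ×ˢ 𝓝 w)
      (𝓝 (kernelGramDet Ω ν m w)) := by
  have hentries : Tendsto (fun (x : ℕ × ℂ) (j k : Fin (m + 1)) =>
      kernelMixedDeriv (D x.1) (μ x.1) j k x.2 x.2) (atTop ×ˢ 𝓝 w)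
      (𝓝 fun j k => kernelMixedDeriv Ω ν j k w w) :=
    tendsto_pi_nhds.2 fun j => tendsto_pi_nhds.2 fun k => H.tendsto_kernelMixedDeriv_diag j k hw
  have hdet : Continuous fun A : Fin (m + 1) → Fin (m + 1) → ℂ => (Matrix.of A).det :=
    continuous_id.matrix_det
  exact (hdet.tendsto _).comp hentries

theorem IsAdmissibleDomain.continuousAt_kernelGramDet {D : Set ℂ} {μ : ℂ → ℝ}
    (hD : IsAdmissibleDomain D μ) (m : ℕ) {w : ℂ} (hw : w ∈ D) :
    ContinuousAt (kernelGramDet D μ m) w := by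
  have h : Tendsto (kernelGramDet D μ m ∘ Prod.snd) ((atTop : Filter ℕ) ×ˢ 𝓝 w)
      (𝓝 (kernelGramDet D μ m w)) := hD.kernelConvergence_const.tendsto_kernelGramDet m hw
  rwa [← tendsto_map'_iff, map_snd_prod] at h

theorem IsAdmissibleDomain.reducedKernel_eq_borderedDetQuotient {D : Set ℂ} {μ : ℂ → ℝ}
    (hD : IsAdmissibleDomain D μ) (n : ℕ) {p : ℂ × ℂ} (hp : p ∈ D ×ˢ D)
    (hJ : kernelGramDet D μ n p.2 ≠ 0) :
    reducedKernel D μ (n + 2) p.1 p.2 = borderedDetQuotient (n := n)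
      (fun j k => kernelMixedDeriv D μ j k p.2 p.2, fun k => kernelMixedDeriv D μ 0 k p.1 p.2) :=
  hD.reducedKernel_eq_det_div n hp.1 hp.2 hJ

namespace KernelConvergence

variable {D : ℕ → Set ℂ} {μ : ℕ → ℂ → ℝ} {Ω : Set ℂ} {ν : ℂ → ℝ}

theorem tendstoContDiffAt_kernelMixedDeriv (H : KernelConvergence D μ Ω ν) (j k : ℕ)
    {p : ℂ × ℂ} (hp : p ∈ Ω ×ˢ Ω) :
    TendstoContDiffAt ℝ atTop ∞ (fun i q => kernelMixedDeriv (D i) (μ i) j k q.1 q.2)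
      (fun q => kernelMixedDeriv Ω ν j k q.1 q.2) p := by
  refine .of_forall_nat ?_ fun m => H.tendstoContDiffAt_natCast_kernelMixedDeriv m j k hp
  filter_upwards [H.eventually_mem_prod hp] with x hx
    using (H.domain x.1).contDiffAt_kernelMixedDeriv j k hx

theorem tendstoContDiffAt_borderedDetQuotient (H : KernelConvergence D μ Ω ν) (n : ℕ)
    {p : ℂ × ℂ} (hp : p ∈ Ω ×ˢ Ω) (hJ : kernelGramDet Ω ν n p.2 ≠ 0) :
    TendstoContDiffAt ℝ atTop ∞
      (fun i q => borderedDetQuotient (n := n) (fun j k => kernelMixedDeriv (D i) (μ i) j k q.2 q.2,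
        fun k => kernelMixedDeriv (D i) (μ i) 0 k q.1 q.2))
      (fun q => borderedDetQuotient (n := n) (fun j k => kernelMixedDeriv Ω ν j k q.2 q.2,
        fun k => kernelMixedDeriv Ω ν 0 k q.1 q.2)) p := by
  have hdiag (j k : ℕ) : TendstoContDiffAt ℝ atTop ∞
      (fun i q => kernelMixedDeriv (D i) (μ i) j k q.2 q.2)
      (fun q => kernelMixedDeriv Ω ν j k q.2 q.2) p :=
    TendstoContDiffAt.comp (u := fun _ q => (q.2, q.2)) (f := fun q : ℂ × ℂ => (q.2, q.2))
      (v := fun i q => kernelMixedDeriv (D i) (μ i) j k q.1 q.2)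
      (g := fun q => kernelMixedDeriv Ω ν j k q.1 q.2)
      (H.tendstoContDiffAt_kernelMixedDeriv j k (p := (p.2, p.2)) ⟨hp.2, hp.2⟩)
      (.of_eventually_contDiffAt (.of_forall fun _ => contDiffAt_snd.prodMk contDiffAt_snd))
  have hentries := (TendstoContDiffAt.pi fun j : Fin (n + 2) => .pi fun k : Fin (n + 2) =>
    hdiag j k).prodMk
      (.pi fun k : Fin (n + 2) => H.tendstoContDiffAt_kernelMixedDeriv 0 k hp)
  refine .comp (.of_eventually_contDiffAt (f := borderedDetQuotient) ?_) hentries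
  have hcont : Continuous fun x : (Fin (n + 2) → Fin (n + 2) → ℂ) × (Fin (n + 2) → ℂ) =>
      ((Matrix.of x.1).submatrix Fin.castSucc Fin.castSucc).det :=
    continuous_fst.matrix_submatrix _ _ |>.matrix_det
  have hne := (hcont.tendsto (fun j k => kernelMixedDeriv Ω ν j k p.2 p.2,
    fun k => kernelMixedDeriv Ω ν 0 k p.1 p.2)).eventually_ne hJ
  exact hne.mono fun x hx => contDiffAt_borderedDetQuotient hx

theorem tendstoContDiffAt_reducedKernel (H : KernelConvergence D μ Ω ν) (n : ℕ)
    {p : ℂ × ℂ} (hp : p ∈ Ω ×ˢ Ω) (hJ : kernelGramDet Ω ν n p.2 ≠ 0) :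
    TendstoContDiffAt ℝ atTop ∞ (fun i q => reducedKernel (D i) (μ i) (n + 2) q.1 q.2)
      (fun q => reducedKernel Ω ν (n + 2) q.1 q.2) p := by
  refine (H.tendstoContDiffAt_borderedDetQuotient n hp hJ).congr ?_ ?_
  · filter_upwards [H.eventually_mem_prod hp,
      (tendsto_id.prodMap continuous_snd.continuousAt).eventually
        ((H.tendsto_kernelGramDet n hp.2).eventually_ne hJ)] with x hx hJx
    exact ((H.domain x.1).reducedKernel_eq_borderedDetQuotient n hx hJx).symm
  · filter_upwards [(H.domain_lim.isOpen.prod H.domain_lim.isOpen).mem_nhds hp,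
      continuous_snd.continuousAt.eventually
        ((H.domain_lim.continuousAt_kernelGramDet n hp.2).eventually_ne hJ)] with q hq hJq
    exact (H.domain_lim.reducedKernel_eq_borderedDetQuotient n hq hJq).symm

theorem tendstoLocallyUniformlyOn_reducedKernel (H : KernelConvergence D μ Ω ν) :
    TendstoLocallyUniformlyOn (fun i (p : ℂ × ℂ) => reducedKernel (D i) (μ i) 1 p.1 p.2)
      (fun p => reducedKernel Ω ν 1 p.1 p.2) atTop (Ω ×ˢ Ω) := by
  refine tendstoLocallyUniformlyOn_of_forall_tendsto_prod (fun p hp => ?_)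
    fun p hp => H.tendsto p.1 hp.1 p.2 hp.2
  simpa only [kernelMixedDeriv_zero_zero] using
    (H.domain_lim.continuousAt_kernelMixedDeriv 0 0 hp).continuousWithinAt

theorem allDerivsTendstoLocallyUniformlyOn (H : KernelConvergence D μ Ω ν) {n : ℕ} (hn : 1 < n) :
    AllDerivsTendstoLocallyUniformlyOn (fun i p => reducedKernel (D i) (μ i) n p.1 p.2)
      (fun p => reducedKernel Ω ν n p.1 p.2) (Ω ×ˢ regularPoints Ω ν n) := by
  obtain ⟨m, rfl⟩ : ∃ m, n = m + 2 := ⟨n - 2, by lia⟩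
  exact allDerivsTendstoLocallyUniformlyOn_of_forall_tendstoContDiffAt fun p hp =>
    H.tendstoContDiffAt_reducedKernel m ⟨hp.1, hp.2.1.1⟩ hp.2.2

end KernelConvergence

end SmoothConvergence

section Comparison

variable {D D' L : Set ℂ} {μ μ' : ℂ → ℝ} {C : ℝ} {m : ℕ} {w : ℂ}

/-- The order on weighted domains along which `∫ |h|² μ dA` is monotone. -/
structure WeightedDomainLE (D' : Set ℂ) (μ' : ℂ → ℝ) (D : Set ℂ) (μ : ℂ → ℝ) : Prop where
  subset : D' ⊆ D
  le : ∀ z ∈ D', μ' z ≤ μ z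

namespace WeightedDomainLE

theorem weightedArea_le (hle : WeightedDomainLE D' μ' D μ) (hD' : IsOpen D') :
    weightedArea D' μ' ≤ weightedArea D μ :=
  calc weightedArea D' μ'
      ≤ (volume.restrict D').withDensity fun z => ENNReal.ofReal (μ z) :=
        withDensity_mono <| (ae_restrict_iff' hD'.measurableSet).2 <|
          .of_forall fun z hz => ENNReal.ofReal_le_ofReal (hle.le z hz)
    _ ≤ weightedArea D μ := Measure.le_iff.2 fun s hs => by
        rw [weightedArea, withDensity_apply _ hs, withDensity_apply _ hs]
        exact lintegral_mono'
          (Measure.restrict_mono le_rfl (Measure.restrict_mono hle.subset le_rfl)) le_rfl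

theorem reducedSpace_le (hle : WeightedDomainLE D' μ' D μ) (hD' : IsOpen D') :
    reducedSpace D μ ≤ reducedSpace D' μ' := fun _ ⟨⟨p, hp⟩, hh⟩ =>
  ⟨⟨p, fun z hz => hp z (hle.subset hz)⟩, hh.mono_measure (hle.weightedArea_le hD')⟩

theorem evalBoundOn (hle : WeightedDomainLE D' μ' D μ) (hD' : IsOpen D')
    (hC : EvalBoundOn D' μ' L C) : EvalBoundOn D μ L C where
  nonneg := hC.nonneg
  sq_norm_le h hh z hz := (hC.sq_norm_le h (hle.reducedSpace_le hD' hh) z hz).trans <|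
    mul_le_mul_of_nonneg_left (l2NormSq_mono (hle.weightedArea_le hD') hh.2) hC.nonneg

theorem l2NormSq_sub_le (hle : WeightedDomainLE D' μ' D μ) (hD' : IsOpen D') {n : ℕ}
    {κ κ' : ℂ → ℂ} (hκ : IsRepresenter D μ m n w κ) (hκ' : IsRepresenter D' μ' m n w κ') :
    l2NormSq (weightedArea D' μ') (κ' - κ) ≤
      l2NormSq (weightedArea D' μ') κ' - l2NormSq (weightedArea D μ) κ := by
  have hmem : κ ∈ vanishingReducedSpace D' μ' m w :=
    ⟨hle.reducedSpace_le hD' hκ.mem.1, hκ.mem.2⟩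
  have hinner : l2Inner (weightedArea D' μ') κ' κ = l2NormSq (weightedArea D μ) κ := by
    rw [← conj_l2Inner, ← hκ'.iteratedDeriv_eq κ hmem, hκ.iteratedDeriv_self, Complex.conj_ofReal]
  rw [l2NormSq_sub hκ'.mem.1.2 hmem.1.2, hinner, Complex.ofReal_re]
  linarith [l2NormSq_mono (hle.weightedArea_le hD') hκ.mem.1.2]

theorem reducedKernelNormSq_le (hle : WeightedDomainLE D' μ' D μ) (hD' : IsAdmissibleDomain D' μ')
    (hD : IsAdmissibleDomain D μ) (hw : w ∈ D') (m : ℕ) :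
    reducedKernelNormSq D μ (m + 1) w ≤ reducedKernelNormSq D' μ' (m + 1) w :=
  sub_nonneg.1 <| (l2NormSq_nonneg _).trans <| hle.l2NormSq_sub_le hD'.isOpen
    (hD.isRepresenter_reducedKernel (hle.subset hw) m) (hD'.isRepresenter_reducedKernel hw m)

theorem sq_norm_sub_reducedKernel_le (hle : WeightedDomainLE D' μ' D μ)
    (hD' : IsAdmissibleDomain D' μ') (hD : IsAdmissibleDomain D μ) (hC : EvalBoundOn D' μ' L C)
    (hw : w ∈ D') (m : ℕ) {z : ℂ} (hz : z ∈ L) :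
    ‖reducedKernel D' μ' (m + 1) z w - reducedKernel D μ (m + 1) z w‖ ^ 2 ≤
      C * (reducedKernelNormSq D' μ' (m + 1) w - reducedKernelNormSq D μ (m + 1) w) := by
  have hκ := hD.isRepresenter_reducedKernel (hle.subset hw) m
  have hκ' := hD'.isRepresenter_reducedKernel hw m
  exact (hC.sq_norm_le _ (sub_mem hκ'.mem.1 (hle.reducedSpace_le hD'.isOpen hκ.mem.1)) z hz).trans
    (mul_le_mul_of_nonneg_left (hle.l2NormSq_sub_le hD'.isOpen hκ hκ') hC.nonneg)

end WeightedDomainLE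

theorem KernelConvergence.of_forall_le {D : ℕ → Set ℂ} {μ : ℕ → ℂ → ℝ} {Ω : Set ℂ} {ν : ℂ → ℝ}
    (hD : ∀ i, IsAdmissibleDomain (D i) (μ i)) (hΩ : IsAdmissibleDomain Ω ν)
    (hle : ∀ i, WeightedDomainLE Ω ν (D i) (μ i))
    (hlim : ∀ t ∈ Ω, Tendsto (fun i => reducedKernel (D i) (μ i) 1 t t) atTop
      (𝓝 (reducedKernel Ω ν 1 t t))) : KernelConvergence D μ Ω ν := by
  refine .of_bound hD hΩ (fun L hLΩ hL => ?_) fun z hz w hw => ?_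
  · obtain ⟨C, hC⟩ := hΩ.isAdmissibleWeight.exists_evalBoundOn hΩ.isOpen hL hLΩ
    exact ⟨C, .of_forall fun i => ⟨hLΩ.trans (hle i).subset, fun z hz w hw =>
      (hD i).norm_reducedKernel_le (hLΩ.trans (hle i).subset)
        ((hle i).evalBoundOn hΩ.isOpen hC) hz hw⟩⟩
  · obtain ⟨C, hC⟩ := hΩ.isAdmissibleWeight.exists_evalBoundOn hΩ.isOpen isCompact_singleton
      (Set.singleton_subset_iff.2 hz)
    have hnorm : Tendsto (fun i => reducedKernelNormSq (D i) (μ i) 1 w) atTop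
        (𝓝 (reducedKernelNormSq Ω ν 1 w)) := by
      have hdiag := hlim w hw
      simp only [hΩ.reducedKernel_one_self hw,
        fun i => (hD i).reducedKernel_one_self ((hle i).subset hw)] at hdiag
      exact tendsto_ofReal_iff.1 hdiag
    have hdiff : Tendsto (fun i => C * (reducedKernelNormSq Ω ν 1 w -
        reducedKernelNormSq (D i) (μ i) 1 w)) atTop (𝓝 0) := by
      simpa using (hnorm.const_sub (reducedKernelNormSq Ω ν 1 w)).const_mul C
    refine (tendstoUniformlyOn_of_sq_norm_sub_le (s := {z})
      (F := fun i ζ => reducedKernel (D i) (μ i) 1 ζ w) hdiff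
      (.of_forall fun i ζ hζ => ?_)).tendsto_at rfl
    rw [norm_sub_rev]
    exact (hle i).sq_norm_sub_reducedKernel_le hΩ (hD i) hC hw 0 hζ

end Comparison

section Exhaustion

theorem lintegral_weightedArea {D : Set ℂ} {μ : ℂ → ℝ} (hD : MeasurableSet D)
    (hμ : AEMeasurable μ (volume.restrict D)) {g : ℂ → ENNReal}
    (hg : AEMeasurable g (volume.restrict D)) :
    ∫⁻ z, g z ∂(weightedArea D μ) = ∫⁻ z, D.indicator (fun z => ENNReal.ofReal (μ z) * g z) z := by
  rw [lintegral_indicator hD, weightedArea,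
    lintegral_withDensity_eq_lintegral_mul₀ hμ.ennreal_ofReal hg]
  rfl

/-- Admissible weighted domains that are eventually increasing and exhaust `Ω`, with weights that
are bounded by `ν` and converge to it almost everywhere. -/
structure IsWeightedExhaustion (D : ℕ → Set ℂ) (μ : ℕ → ℂ → ℝ) (Ω : Set ℂ) (ν : ℂ → ℝ) :
    Prop where
  domain : ∀ i, IsAdmissibleDomain (D i) (μ i)
  iUnion_eq : ⋃ i, D i = Ω
  admissible_lim : IsAdmissibleWeight Ω ν
  eventually_le : ∀ i, ∀ᶠ k in atTop, WeightedDomainLE (D i) (μ i) (D k) (μ k)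
  le_lim : ∀ i, WeightedDomainLE (D i) (μ i) Ω ν
  ae_tendsto : ∀ᵐ z ∂(volume.restrict Ω), Tendsto (fun i => μ i z) atTop (𝓝 (ν z))

namespace IsWeightedExhaustion

variable {D : ℕ → Set ℂ} {μ : ℕ → ℂ → ℝ} {Ω : Set ℂ} {ν : ℂ → ℝ}

theorem directed (H : IsWeightedExhaustion D μ Ω ν) : Directed (· ⊆ ·) D := fun i k => by
  obtain ⟨j, hi, hk⟩ := ((H.eventually_le i).and (H.eventually_le k)).exists
  exact ⟨j, hi.subset, hk.subset⟩

theorem domain_lim (H : IsWeightedExhaustion D μ Ω ν) : IsAdmissibleDomain Ω ν where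
  isOpen := H.iUnion_eq ▸ isOpen_iUnion fun i => (H.domain i).isOpen
  isPreconnected := by
    rw [← H.iUnion_eq, ← Set.sUnion_range]
    exact IsPreconnected.sUnion_directed H.directed.directedOn_range
      (Set.forall_mem_range.2 fun i => (H.domain i).isPreconnected)
  isAdmissibleWeight := H.admissible_lim

theorem exists_eventually_evalBoundOn (H : IsWeightedExhaustion D μ Ω ν) {L : Set ℂ}
    (hLΩ : L ⊆ Ω) (hL : IsCompact L) :
    ∃ C : ℝ, ∀ᶠ i in atTop, L ⊆ D i ∧ EvalBoundOn (D i) (μ i) L C := by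
  obtain ⟨i, hi⟩ := hL.elim_directed_cover D (fun i => (H.domain i).isOpen)
    (hLΩ.trans H.iUnion_eq.ge) H.directed
  obtain ⟨C, hC⟩ := (H.domain i).isAdmissibleWeight.exists_evalBoundOn (H.domain i).isOpen hL hi
  exact ⟨C, (H.eventually_le i).mono fun k hk =>
    ⟨hi.trans hk.subset, hk.evalBoundOn (H.domain i).isOpen hC⟩⟩

theorem eventually_mem_prod (H : IsWeightedExhaustion D μ Ω ν) {z : ℂ} (hz : z ∈ Ω) :
    ∀ᶠ x : ℕ × ℂ in atTop ×ˢ 𝓝 z, x.2 ∈ D x.1 := by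
  obtain ⟨i, hi⟩ := Set.mem_iUnion.1 (H.iUnion_eq.ge hz)
  filter_upwards [prod_mem_prod (H.eventually_le i) ((H.domain i).isOpen.mem_nhds hi)] with x hx
  exact hx.1.subset hx.2

theorem eventually_mem (H : IsWeightedExhaustion D μ Ω ν) {z : ℂ} (hz : z ∈ Ω) :
    ∀ᶠ i in atTop, z ∈ D i :=
  (H.eventually_mem_prod hz).curry.mono fun _ hi => hi.self_of_nhds

theorem lintegral_weightedArea_le_liminf (H : IsWeightedExhaustion D μ Ω ν) {G : ℕ → ℂ → ENNReal}
    {g : ℂ → ENNReal} (hG : ∀ i, AEMeasurable (G i) (volume.restrict (D i)))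
    (hg : AEMeasurable g (volume.restrict Ω))
    (hlim : ∀ z ∈ Ω, Tendsto (fun i => G i z) atTop (𝓝 (g z))) :
    ∫⁻ z, g z ∂(weightedArea Ω ν) ≤
      liminf (fun i => ∫⁻ z, G i z ∂(weightedArea (D i) (μ i))) atTop := by
  have hΩm := H.domain_lim.isOpen.measurableSet
  have hDm (i : ℕ) := (H.domain i).isOpen.measurableSet
  have hμm (i : ℕ) := (H.domain i).isAdmissibleWeight.measurable
  simp only [lintegral_weightedArea hΩm H.admissible_lim.measurable hg,
    fun i => lintegral_weightedArea (hDm i) (hμm i) (hG i)]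
  refine (lintegral_mono_ae ?_).trans (lintegral_liminf_le' fun i =>
    (aemeasurable_indicator_iff (hDm i)).2 ((hμm i).ennreal_ofReal.mul (hG i)))
  filter_upwards [(ae_restrict_iff' hΩm).1 H.ae_tendsto] with z hν
  by_cases hz : z ∈ Ω
  · have hmul : Tendsto (fun i => ENNReal.ofReal (μ i z) * G i z) atTop
        (𝓝 (ENNReal.ofReal (ν z) * g z)) :=
      ENNReal.Tendsto.mul (ENNReal.tendsto_ofReal (hν hz))
        (.inl (ENNReal.ofReal_pos.2 (H.admissible_lim.pos z hz)).ne') (hlim z hz)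
        (.inr ENNReal.ofReal_ne_top)
    rw [Set.indicator_of_mem hz]
    refine (hmul.congr' ?_).liminf_eq.ge
    filter_upwards [H.eventually_mem hz] with i hi
    rw [Set.indicator_of_mem hi]
  · rw [Set.indicator_of_notMem hz]
    exact zero_le

theorem memLp_and_l2NormSq_le_of_tendsto (H : IsWeightedExhaustion D μ Ω ν) {F : ℕ → ℂ → ℂ}
    {f : ℂ → ℂ} {α : ℝ} (hF : ∀ i, ContinuousOn (F i) (D i)) (hf : ContinuousOn f Ω)
    (hlim : ∀ z ∈ Ω, Tendsto (fun i => F i z) atTop (𝓝 (f z)))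
    (hF_memLp : ∀ᶠ i in atTop, MemLp (F i) 2 (weightedArea (D i) (μ i)))
    (hα : Tendsto (fun i => l2NormSq (weightedArea (D i) (μ i)) (F i)) atTop (𝓝 α)) :
    MemLp f 2 (weightedArea Ω ν) ∧ l2NormSq (weightedArea Ω ν) f ≤ α := by
  have hfm := hf.aestronglyMeasurable (μ := volume) H.domain_lim.isOpen.measurableSet
  have hle : ∫⁻ z, ‖f z‖ₑ ^ 2 ∂(weightedArea Ω ν) ≤ ENNReal.ofReal α := by
    refine (H.lintegral_weightedArea_le_liminf (G := fun i z => ‖F i z‖ₑ ^ 2)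
      (fun i => ((hF i).aestronglyMeasurable (H.domain i).isOpen.measurableSet).enorm.pow_const 2)
      (hfm.enorm.pow_const 2)
      fun z hz => ((ENNReal.continuous_pow 2).tendsto _).comp (hlim z hz).enorm).trans_eq ?_
    refine ((ENNReal.tendsto_ofReal hα).congr' ?_).liminf_eq
    exact hF_memLp.mono fun i hi => (lintegral_enorm_sq_eq_ofReal_l2NormSq hi).symm
  have hf_memLp : MemLp f 2 (weightedArea Ω ν) := memLp_two_of_lintegral_enorm_sq_lt_top
    (hfm.mono_ac (withDensity_absolutelyContinuous _ _)) (hle.trans_lt ENNReal.ofReal_lt_top)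
  refine ⟨hf_memLp, ?_⟩
  rw [lintegral_enorm_sq_eq_ofReal_l2NormSq hf_memLp] at hle
  exact (ENNReal.ofReal_le_ofReal_iff (ge_of_tendsto' hα fun i => l2NormSq_nonneg _)).1 hle

theorem tendsto_iteratedDeriv (H : IsWeightedExhaustion D μ Ω ν) {F : ℕ → ℂ → ℂ} {f : ℂ → ℂ}
    (hF : ∀ i, DifferentiableOn ℂ (F i) (D i)) (hlim : TendstoLocallyUniformlyOn F f atTop Ω)
    {w : ℂ} (hw : w ∈ Ω) (k : ℕ) :
    Tendsto (fun i => iteratedDeriv k (F i) w) atTop (𝓝 (iteratedDeriv k f w)) := by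
  obtain ⟨i, hi⟩ := Set.mem_iUnion.1 (H.iUnion_eq.ge hw)
  exact (tendstoLocallyUniformlyOn_iteratedDeriv (H.domain i).isOpen
    (hlim.mono (H.le_lim i).subset)
    ((H.eventually_le i).mono fun k hk => (hF k).mono hk.subset) k).tendsto_at hi

theorem exists_tendsto_reducedKernelNormSq (H : IsWeightedExhaustion D μ Ω ν) {w : ℂ} (hw : w ∈ Ω)
    (m : ℕ) : ∃ α, Tendsto (fun i => reducedKernelNormSq (D i) (μ i) (m + 1) w) atTop (𝓝 α) ∧
      ∀ᶠ i in atTop, α ≤ reducedKernelNormSq (D i) (μ i) (m + 1) w :=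
  exists_tendsto_of_eventually_eventually_le
    (isBoundedUnder_of_eventually_ge (.of_forall fun _ => l2NormSq_nonneg _)) <|
    (H.eventually_mem hw).mono fun i hi => (H.eventually_le i).mono fun k hk =>
      hk.reducedKernelNormSq_le (H.domain i) (H.domain k) hi m

theorem exists_tendstoLocallyUniformlyOn_reducedKernel (H : IsWeightedExhaustion D μ Ω ν) {w : ℂ}
    (hw : w ∈ Ω) (m : ℕ) : ∃ h, TendstoLocallyUniformlyOn
      (fun i z => reducedKernel (D i) (μ i) (m + 1) z w) h atTop Ω := by
  obtain ⟨α, hα, hα_le⟩ := H.exists_tendsto_reducedKernelNormSq hw m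
  refine exists_tendstoLocallyUniformlyOn_of_uniformCauchySeqOn H.domain_lim.isOpen
    fun L hLΩ hL => ?_
  obtain ⟨C, hC⟩ := H.exists_eventually_evalBoundOn hLΩ hL
  refine uniformCauchySeqOn_of_sq_norm_sub_le
    (b := fun i => C * (reducedKernelNormSq (D i) (μ i) (m + 1) w - α))
    (by simpa using (hα.sub_const α).const_mul C) ?_
  filter_upwards [hC, H.eventually_mem hw] with i hCi hi
  filter_upwards [H.eventually_le i, hα_le] with k hik hαk z hz
  exact (hik.sq_norm_sub_reducedKernel_le (H.domain i) (H.domain k) hCi.2 hi m hz).trans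
    (mul_le_mul_of_nonneg_left (sub_le_sub_left hαk _) hCi.2.nonneg)

theorem mem_vanishingReducedSpace_and_l2NormSq_le_of_tendstoLocallyUniformlyOn
    (H : IsWeightedExhaustion D μ Ω ν) {w : ℂ} (hw : w ∈ Ω) {m : ℕ} {h : ℂ → ℂ} {α : ℝ}
    (hlim : TendstoLocallyUniformlyOn (fun i z => reducedKernel (D i) (μ i) (m + 1) z w) h atTop Ω)
    (hα : Tendsto (fun i => reducedKernelNormSq (D i) (μ i) (m + 1) w) atTop (𝓝 α)) :
    h ∈ vanishingReducedSpace Ω ν m w ∧ l2NormSq (weightedArea Ω ν) h ≤ α := by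
  have hrep := (H.eventually_mem hw).mono fun i hi => (H.domain i).isRepresenter_reducedKernel hi m
  have hdiff (i : ℕ) := differentiableOn_reducedKernel (H.domain i).isOpen (μ i) (m + 1) w
  have hexact : Complex.IsExactOn h Ω :=
    isExactOn_of_tendstoLocallyUniformlyOn H.domain_lim.isOpen H.domain_lim.isPreconnected
      (f := fun i => kernelFunction (D i) (μ i) (m + 1) w) hlim fun z hz =>
        (H.eventually_mem_prod hz).mono fun x hx =>
          hasDerivAt_kernelFunction (H.domain x.1).isOpen _ _ _ hx
  obtain ⟨hL2, hle⟩ := H.memLp_and_l2NormSq_le_of_tendsto (fun i => (hdiff i).continuousOn)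
    (hexact.differentiableOn H.domain_lim.isOpen).continuousOn (fun z hz => hlim.tendsto_at hz)
    (hrep.mono fun i hi => hi.mem.1.2) hα
  refine ⟨(mem_vanishingReducedSpace H.domain_lim.isOpen hw).2 ⟨⟨hexact, hL2⟩, fun k hk => ?_⟩, hle⟩
  exact tendsto_nhds_unique (H.tendsto_iteratedDeriv hdiff hlim hw k)
    (tendsto_const_nhds.congr' (hrep.mono fun i hi => (hi.mem.2.2 k hk).symm))

theorem tendstoLocallyUniformlyOn_reducedKernel (H : IsWeightedExhaustion D μ Ω ν) {w : ℂ}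
    (hw : w ∈ Ω) (m : ℕ) : TendstoLocallyUniformlyOn
      (fun i z => reducedKernel (D i) (μ i) (m + 1) z w)
      (fun z => reducedKernel Ω ν (m + 1) z w) atTop Ω := by
  obtain ⟨α, hα, -⟩ := H.exists_tendsto_reducedKernelNormSq hw m
  obtain ⟨h, hh⟩ := H.exists_tendstoLocallyUniformlyOn_reducedKernel hw m
  obtain ⟨hmem, hh_le⟩ :=
    H.mem_vanishingReducedSpace_and_l2NormSq_le_of_tendstoLocallyUniformlyOn hw hh hα
  have hvalue : iteratedDeriv m h w = α := by
    refine tendsto_nhds_unique (H.tendsto_iteratedDeriv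
      (fun i => differentiableOn_reducedKernel (H.domain i).isOpen _ _ _) hh hw m)
      ((tendsto_ofReal_iff.2 hα).congr' ?_)
    filter_upwards [H.eventually_mem hw] with i hi
    exact ((H.domain i).isRepresenter_reducedKernel hi m).iteratedDeriv_self.symm
  have hlim_le : reducedKernelNormSq Ω ν (m + 1) w ≤ α :=
    ge_of_tendsto hα <| (H.eventually_mem hw).mono fun i hi =>
      (H.le_lim i).reducedKernelNormSq_le (H.domain i) H.domain_lim hi m
  refine hh.congr_right ((H.domain_lim.isRepresenter_reducedKernel hw m).eqOn_of_l2NormSq_le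
    H.domain_lim hmem ?_ ?_)
  all_goals rw [hvalue, Complex.ofReal_re]
  exacts [hh_le, hlim_le]

theorem kernelConvergence (H : IsWeightedExhaustion D μ Ω ν) : KernelConvergence D μ Ω ν := by
  refine .of_bound H.domain H.domain_lim (fun L hLΩ hL => ?_)
    fun z hz w hw => (H.tendstoLocallyUniformlyOn_reducedKernel hw 0).tendsto_at hz
  obtain ⟨C, hC⟩ := H.exists_eventually_evalBoundOn hLΩ hL
  exact ⟨C, hC.mono fun i hi => ⟨hi.1, fun z hz w hw =>
    (H.domain i).norm_reducedKernel_le hi.1 hi.2 hz hw⟩⟩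

end IsWeightedExhaustion

end Exhaustion

theorem mainTheorem3_general (D : ℕ → Set ℂ) (μ : ℕ → ℂ → ℝ)
    (hD : ∀ i, IsOpen (D i) ∧ IsConnected (D i))
    (hμ : ∀ i, IsAdmissibleWeight (D i) (μ i)) :
    (∀ (Ω : Set ℂ) (ν : ℂ → ℝ), Ω = ⋃ i, D i → IsAdmissibleWeight Ω ν →
      (∀ i, ∃ j, ∀ k ≥ j, D i ⊆ D k ∧ ∀ z ∈ D i, μ i z ≤ μ k z ∧ μ k z ≤ ν z) →
      (∀ᵐ z ∂(volume.restrict Ω), Tendsto (fun i => μ i z) atTop (𝓝 (ν z))) →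
      TendstoLocallyUniformlyOn
        (fun i (p : ℂ × ℂ) => reducedKernel (D i) (μ i) 1 p.1 p.2)
        (fun p => reducedKernel Ω ν 1 p.1 p.2) atTop (Ω ×ˢ Ω) ∧
      ∀ n : ℕ, 1 < n →
        (∀ w ∈ Ω, TendstoLocallyUniformlyOn
          (fun i z => reducedKernel (D i) (μ i) n z w)
          (fun z => reducedKernel Ω ν n z w) atTop Ω) ∧
        (∀ z ∈ Ω, ∀ w ∈ Ω, Tendsto (fun i => reducedKernel (D i) (μ i) n z w) atTop
          (𝓝 (reducedKernel Ω ν n z w))) ∧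
        AllDerivsTendstoLocallyUniformlyOn
          (fun i p => reducedKernel (D i) (μ i) n p.1 p.2)
          (fun p => reducedKernel Ω ν n p.1 p.2) (Ω ×ˢ regularPoints Ω ν n)) ∧
    (∀ (Ω : Set ℂ) (ν : ℂ → ℝ), (∀ i, Ω ⊆ D i) → IsOpen Ω → IsConnected Ω →
      IsAdmissibleWeight Ω ν →
      (∀ i, ∀ z ∈ Ω, ν z ≤ μ i z) →
      (∀ t ∈ Ω, Tendsto (fun i => reducedKernel (D i) (μ i) 1 t t) atTop
        (𝓝 (reducedKernel Ω ν 1 t t))) →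
      TendstoLocallyUniformlyOn
        (fun i (p : ℂ × ℂ) => reducedKernel (D i) (μ i) 1 p.1 p.2)
        (fun p => reducedKernel Ω ν 1 p.1 p.2) atTop (Ω ×ˢ Ω) ∧
      ∀ n : ℕ, 1 < n →
        AllDerivsTendstoLocallyUniformlyOn
          (fun i p => reducedKernel (D i) (μ i) n p.1 p.2)
          (fun p => reducedKernel Ω ν n p.1 p.2) (Ω ×ˢ regularPoints Ω ν n)) := by
  have hdom (i : ℕ) : IsAdmissibleDomain (D i) (μ i) := ⟨(hD i).1, (hD i).2.isPreconnected, hμ i⟩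
  refine ⟨fun Ω ν hΩ hν hmono hlim => ?_, fun Ω ν hΩ hΩo hΩc hν hle hlim => ?_⟩
  · have H : IsWeightedExhaustion D μ Ω ν :=
      { domain := hdom
        iUnion_eq := hΩ.symm
        admissible_lim := hν
        eventually_le := fun i => eventually_atTop.2 <| (hmono i).imp fun _ h k hk =>
          ⟨(h k hk).1, fun z hz => ((h k hk).2 z hz).1⟩
        le_lim := fun i => ⟨hΩ ▸ Set.subset_iUnion D i, fun z hz =>
          let ⟨j, h⟩ := hmono i
          ((h j le_rfl).2 z hz).1.trans ((h j le_rfl).2 z hz).2⟩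
        ae_tendsto := hlim }
    refine ⟨H.kernelConvergence.tendstoLocallyUniformlyOn_reducedKernel, fun n hn => ?_⟩
    obtain ⟨m, rfl⟩ := Nat.exists_eq_add_one_of_ne_zero (Nat.ne_zero_of_lt hn)
    exact ⟨fun w hw => H.tendstoLocallyUniformlyOn_reducedKernel hw m,
      fun z hz w hw => (H.tendstoLocallyUniformlyOn_reducedKernel hw m).tendsto_at hz,
      H.kernelConvergence.allDerivsTendstoLocallyUniformlyOn hn⟩
  · have H := KernelConvergence.of_forall_le hdom ⟨hΩo, hΩc.isPreconnected, hν⟩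
      (fun i => ⟨hΩ i, hle i⟩) hlim
    exact ⟨H.tendstoLocallyUniformlyOn_reducedKernel,
      fun n hn => H.allDerivsTendstoLocallyUniformlyOn hn⟩

theorem mainTheorem3 (D : ℕ → Set ℂ) (μ : ℕ → ℂ → ℝ)
    (hD : ∀ i, IsOpen (D i) ∧ IsConnected (D i))
    (hμ : ∀ i, IsAdmissibleWeight (D i) (μ i)) :
    -- Part (1)
    (∀ (Ω : Set ℂ) (ν : ℂ → ℝ), Ω = ⋃ i, D i → IsAdmissibleWeight Ω ν →
      (∀ i, ∃ j, ∀ k ≥ j, D i ⊆ D k ∧ ∀ z ∈ D i, μ i z ≤ μ k z ∧ μ k z ≤ ν z) →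
      (∀ᵐ z ∂(volume.restrict Ω), Tendsto (fun i => μ i z) atTop (𝓝 (ν z))) →
      TendstoLocallyUniformlyOn
        (fun i (p : ℂ × ℂ) => reducedKernel (D i) (μ i) 1 p.1 p.2)
        (fun p => reducedKernel Ω ν 1 p.1 p.2) atTop (Ω ×ˢ Ω) ∧
      ∀ n : ℕ, 1 < n →
        (∀ w ∈ Ω, TendstoLocallyUniformlyOn
          (fun i z => reducedKernel (D i) (μ i) n z w)
          (fun z => reducedKernel Ω ν n z w) atTop Ω) ∧
        (∀ z ∈ Ω, ∀ w ∈ Ω, Tendsto (fun i => reducedKernel (D i) (μ i) n z w) atTop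
          (𝓝 (reducedKernel Ω ν n z w))) ∧
        AllDerivsTendstoLocallyUniformlyOn
          (fun i p => reducedKernel (D i) (μ i) n p.1 p.2)
          (fun p => reducedKernel Ω ν n p.1 p.2) (Ω ×ˢ regularPoints Ω ν n)) ∧
    -- Part (2)
    (∀ (Ω : Set ℂ) (ν : ℂ → ℝ), Ω = ⋂ i, D i → IsOpen Ω → IsConnected Ω →
      IsAdmissibleWeight Ω ν →
      (∀ i, ∀ z ∈ Ω, ν z ≤ μ i z) →
      (∀ᵐ z ∂(volume.restrict Ω), Tendsto (fun i => μ i z) atTop (𝓝 (ν z))) →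
      (∀ t ∈ Ω, Tendsto (fun i => reducedKernel (D i) (μ i) 1 t t) atTop
        (𝓝 (reducedKernel Ω ν 1 t t))) →
      TendstoLocallyUniformlyOn
        (fun i (p : ℂ × ℂ) => reducedKernel (D i) (μ i) 1 p.1 p.2)
        (fun p => reducedKernel Ω ν 1 p.1 p.2) atTop (Ω ×ˢ Ω) ∧
      ∀ n : ℕ, 1 < n →
        AllDerivsTendstoLocallyUniformlyOn
          (fun i p => reducedKernel (D i) (μ i) n p.1 p.2)
          (fun p => reducedKernel Ω ν n p.1 p.2) (Ω ×ˢ regularPoints Ω ν n)) := by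
  exact (mainTheorem3_general D μ hD hμ).imp_right fun h Ω ν hΩ hΩo hΩc hν hle _ =>
    h Ω ν (fun i => hΩ ▸ Set.iInter_subset D i) hΩo hΩc hν hle
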